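/- Let $F$ be a field. A \emph{reduced skew set} of degree $n\ge 1$ is a family of scalars $c_{ijk}\in F$ ($1\le i,j,k\le n$) with $c_{iij}=c_{ijj}=1$ for all $i,j$; the associated \emph{skew matrix algebra} $M_n(F;c)$ is the unital, not necessarily associative $F$-algebra with basis $\{e_{ij}\}_{1\le i,j\le n}$ and multiplication $e_{ij}e_{k\ell}=\delta_{jk}c_{ij\ell}e_{i\ell}$. A finite-dimensional unital, not necessarily associative $F$-algebra $A\neq 0$ with center $F$ is \emph{semiassociative} if there is an étale $F$-subalgebra $K$ (with the same unit) of its nucleus such that $A$, as a $K\otimes_F K$-module via $(k\otimes k')a=kak'$, is minimally faithful, i.e. faithful and without faithful proper sections (quotients of submodules). Call algebras $A,B$ \emph{skew equivalent} if $A\otimes_F M_n(F;c)\cong B\otimes_F M_{n'}(F;c')$ for some skew matrix algebras of degrees $n,n'\ge 1$. The semiassociative Brauer monoid $\mathrm{Br}_{sa}(F)$ is the set of skew equivalence classes $[A]^{sa}$ of semiassociative $F$-algebras, with product $[A]^{sa}[B]^{sa}=[A\otimes_F B]^{sa}$ and identity $[F]^{sa}$. Let $\mathrm{Br}(F)$ be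 the classical Brauer group of $F$. Then: 1. If two finite-dimensional associative central simple $F$-algebras $A,B$ are skew equivalent, then they are Brauer equivalent in the classical sense, i.e. $M_n(A)\cong M_m(B)$ as $F$-algebras for some $n,m\ge 1$. 2. Every finite-dimensional associative central simple $F$-algebra is semiassociative, and $[A]\mapsto[A]^{sa}$ is a well-defined injective homomorphism of monoids $\mathrm{Br}(F)\hookrightarrow\mathrm{Br}_{sa}(F)$. -/

import Mathlib

open scoped TensorProduct

universe u v w

/-! ## Skew matrix algebras -/

/-- A reduced skew set over `F` with indices in `ι`: scalars `c i j k` with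
`c i i j = c i j j = 1`. -/
structure SkewSet (F : Type u) (ι : Type v) [Field F] where
  coeff : ι → ι → ι → F
  left_one : ∀ i j, coeff i i j = 1
  right_one : ∀ i j, coeff i j j = 1

/-- The skew matrix algebra of a reduced skew set `c`: as a vector space these are the square
matrices, and the matrix units multiply by `e i j * e j l = c i j l • e i l`. -/
def SkewMatrix {F : Type u} {ι : Type v} [Field F] (_c : SkewSet F ι) : Type (max u v) :=
  Matrix ι ι F

namespace SkewMatrix

variable {F : Type u} {ι : Type v} [Field F] (c : SkewSet F ι)

instance : AddCommGroup (SkewMatrix c) := inferInstanceAs (AddCommGroup (Matrix ι ι F))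

instance : Module F (SkewMatrix c) := inferInstanceAs (Module F (Matrix ι ι F))

variable {c}

@[ext] theorem ext {x y : SkewMatrix c} (h : ∀ i j, x i j = y i j) : x = y :=
  funext fun i => funext fun j => h i j

@[simp] theorem add_apply (x y : SkewMatrix c) (i j : ι) : (x + y) i j = x i j + y i j := rfl

@[simp] theorem zero_apply (i j : ι) : (0 : SkewMatrix c) i j = 0 := rfl

@[simp] theorem smul_apply (r : F) (x : SkewMatrix c) (i j : ι) : (r • x) i j = r * x i j := rfl

section

variable [DecidableEq ι]

instance : One (SkewMatrix c) where
  one := fun i j => if i = j then 1 else 0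

theorem one_apply (i j : ι) : (1 : SkewMatrix c) i j = if i = j then 1 else 0 := rfl

end

variable [Fintype ι]

instance : Mul (SkewMatrix c) where
  mul x y := fun i l => ∑ j, c.coeff i j l * (x i j * y j l)

theorem mul_apply (x y : SkewMatrix c) (i l : ι) :
    (x * y) i l = ∑ j, c.coeff i j l * (x i j * y j l) := rfl

variable [DecidableEq ι]

instance : NonAssocRing (SkewMatrix c) where
  left_distrib x y z := by
    ext i l; simp [mul_apply, mul_add, Finset.sum_add_distrib]
  right_distrib x y z := by
    ext i l; simp [mul_apply, mul_add, add_mul, Finset.sum_add_distrib]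
  zero_mul x := by ext i l; simp [mul_apply]
  mul_zero x := by ext i l; simp [mul_apply]
  one_mul x := by ext i l; simp [mul_apply, one_apply, c.left_one]
  mul_one x := by ext i l; simp [mul_apply, one_apply, c.right_one]

instance : IsScalarTower F (SkewMatrix c) (SkewMatrix c) where
  smul_assoc r x y := by
    ext i l
    simp only [smul_eq_mul, mul_apply, smul_apply, Finset.mul_sum]
    exact Finset.sum_congr rfl fun j _ => by ring

instance : SMulCommClass F (SkewMatrix c) (SkewMatrix c) where
  smul_comm r x y := by
    ext i l
    simp only [smul_eq_mul, mul_apply, smul_apply, Finset.mul_sum]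
    exact Finset.sum_congr rfl fun j _ => by ring

end SkewMatrix

/-! ## Isomorphisms of nonassociative algebras -/

section Iso

variable (F : Type u) [Field F]

/-- Two (unital, not necessarily associative) `F`-algebras are isomorphic. A multiplicative
linear bijection automatically respects the unit. -/
def IsAlgIso (A : Type*) (B : Type*) [NonAssocRing A] [Module F A]
    [NonAssocRing B] [Module F B] : Prop :=
  ∃ e : A ≃ₗ[F] B, ∀ x y : A, e (x * y) = e x * e y

/-- `A ⊗ M ≅ B ⊗ M'` for skew matrix algebras `M`, `M'` of positive degree. -/
def IsSkewEquivalent (A : Type*) (B : Type*)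
    [NonAssocRing A] [Module F A] [SMulCommClass F A A] [IsScalarTower F A A]
    [NonAssocRing B] [Module F B] [SMulCommClass F B B] [IsScalarTower F B B] : Prop :=
  ∃ (n n' : ℕ) (c : SkewSet F (Fin n)) (c' : SkewSet F (Fin n')), 0 < n ∧ 0 < n' ∧
    IsAlgIso F (A ⊗[F] SkewMatrix c) (B ⊗[F] SkewMatrix c')

namespace IsAlgIso

variable {F}
variable {A A' B B' C D : Type*}
  [NonAssocRing A] [Module F A] [NonAssocRing A'] [Module F A']
  [NonAssocRing B] [Module F B] [NonAssocRing B'] [Module F B']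
  [NonAssocRing C] [Module F C] [NonAssocRing D] [Module F D]

theorem refl : IsAlgIso F A A := ⟨LinearEquiv.refl F A, fun _ _ => rfl⟩

theorem symm (h : IsAlgIso F A B) : IsAlgIso F B A := by
  obtain ⟨e, he⟩ := h
  exact ⟨e.symm, fun x y => e.injective (by simp [he])⟩

theorem trans (h : IsAlgIso F A B) (h' : IsAlgIso F B C) : IsAlgIso F A C := by
  obtain ⟨e, he⟩ := h
  obtain ⟨f, hf⟩ := h'
  exact ⟨e.trans f, fun x y => by simp [he, hf]⟩

variable [SMulCommClass F A A] [IsScalarTower F A A] [SMulCommClass F A' A'] [IsScalarTower F A' A']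
  [SMulCommClass F B B] [IsScalarTower F B B] [SMulCommClass F B' B'] [IsScalarTower F B' B']
  [SMulCommClass F C C] [IsScalarTower F C C] [SMulCommClass F D D] [IsScalarTower F D D]


theorem map_mul_of_tmul {R : Type*} [NonAssocRing R] [Module F R] (e : A ⊗[F] B ≃ₗ[F] R)
    (h : ∀ a b a' b', e ((a * a') ⊗ₜ (b * b')) = e (a ⊗ₜ b) * e (a' ⊗ₜ b')) (x y : A ⊗[F] B) :
    e (x * y) = e x * e y := by
  induction x with
  | zero => simp
  | add x x' hx hx' => simp [add_mul, hx, hx']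
  | tmul a b =>
    induction y with
    | zero => simp
    | add y y' hy hy' => simp [mul_add, hy, hy']
    | tmul a' b' => simp [h]

theorem tensor (h : IsAlgIso F A A') (h' : IsAlgIso F B B') :
    IsAlgIso F (A ⊗[F] B) (A' ⊗[F] B') := by
  obtain ⟨e, he⟩ := h
  obtain ⟨f, hf⟩ := h'
  exact ⟨TensorProduct.congr e f,
    map_mul_of_tmul (TensorProduct.congr e f) fun a b a' b' => by simp [he, hf]⟩

theorem comm : IsAlgIso F (A ⊗[F] B) (B ⊗[F] A) :=
  ⟨TensorProduct.comm F A B,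
    map_mul_of_tmul (TensorProduct.comm F A B) fun a b a' b' => by simp⟩

theorem lid : IsAlgIso F (F ⊗[F] A) A :=
  ⟨TensorProduct.lid F A,
    map_mul_of_tmul (TensorProduct.lid F A) fun a b a' b' => by
      simp [mul_smul, smul_mul_assoc, mul_smul_comm, smul_comm a a']⟩

theorem assoc : IsAlgIso F ((A ⊗[F] B) ⊗[F] C) (A ⊗[F] (B ⊗[F] C)) := by
  refine ⟨TensorProduct.assoc F A B C, fun x y => ?_⟩
  refine map_mul_of_tmul (A := A ⊗[F] B) (B := C) (R := A ⊗[F] (B ⊗[F] C)) (TensorProduct.assoc F A B C)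
    (fun x c x' c' => ?_) x y
  induction x with
  | zero => simp
  | add x y hx hy => simp only [add_mul, TensorProduct.add_tmul, map_add, hx, hy]
  | tmul a b =>
    induction x' with
    | zero => simp
    | add x y hx hy => simp only [mul_add, TensorProduct.add_tmul, map_add, hx, hy]
    | tmul a' b' => simp

theorem tensorComm : IsAlgIso F ((A ⊗[F] B) ⊗[F] (C ⊗[F] D)) ((A ⊗[F] C) ⊗[F] (B ⊗[F] D)) := by
  refine ⟨TensorProduct.tensorTensorTensorComm F A B C D, fun x y => ?_⟩
  refine map_mul_of_tmul (A := A ⊗[F] B) (B := C ⊗[F] D)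
    (R := (A ⊗[F] C) ⊗[F] (B ⊗[F] D))
    (TensorProduct.tensorTensorTensorComm F A B C D) (fun x z x' z' => ?_) x y
  induction x with
  | zero => simp
  | add x y hx hy => simp only [add_mul, TensorProduct.add_tmul, map_add, hx, hy]
  | tmul a b =>
    induction x' with
    | zero => simp
    | add x y hx hy => simp only [mul_add, TensorProduct.add_tmul, map_add, hx, hy]
    | tmul a' b' =>
      induction z with
      | zero => simp
      | add x y hx hy => simp only [add_mul, TensorProduct.tmul_add, map_add, hx, hy]
      | tmul c d =>
        induction z' with
        | zero => simp
        | add x y hx hy => simp only [mul_add, TensorProduct.tmul_add, map_add, hx, hy]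
        | tmul c' d' => simp

end IsAlgIso

/-! ## Tensor products of skew matrix algebras -/

namespace SkewSet

variable {F} {ι κ : Type*}

/-- The tensor product of two skew sets. -/
def tensor (c : SkewSet F ι) (d : SkewSet F κ) : SkewSet F (ι × κ) where
  coeff i j k := c.coeff i.1 j.1 k.1 * d.coeff i.2 j.2 k.2
  left_one i j := by simp [c.left_one, d.left_one]
  right_one i j := by simp [c.right_one, d.right_one]

/-- Renaming of the indices of a skew set. -/
def reindex (e : κ ≃ ι) (c : SkewSet F ι) : SkewSet F κ where
  coeff i j k := c.coeff (e i) (e j) (e k)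
  left_one _ _ := c.left_one _ _
  right_one _ _ := c.right_one _ _

variable [Fintype ι] [DecidableEq ι] [Fintype κ] [DecidableEq κ]

theorem reindex_iso (e : κ ≃ ι) (c : SkewSet F ι) :
    IsAlgIso F (SkewMatrix c) (SkewMatrix (c.reindex e)) := by
  refine ⟨{ toFun := fun x i j => x (e i) (e j), invFun := fun x i j => x (e.symm i) (e.symm j),
            map_add' := fun _ _ => rfl, map_smul' := fun _ _ => rfl,
            left_inv := fun x => ?_, right_inv := fun x => ?_ }, fun x y => ?_⟩
  · ext i j; simp
  · ext i j; simp
  · ext i l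
    change (x * y) (e i) (e l) = _
    rw [SkewMatrix.mul_apply, SkewMatrix.mul_apply]
    exact (Equiv.sum_comp e _).symm

theorem tensor_iso (c : SkewSet F ι) (d : SkewSet F κ) :
    IsAlgIso F (SkewMatrix c ⊗[F] SkewMatrix d) (SkewMatrix (c.tensor d)) := by
  let e : Matrix ι ι F ⊗[F] Matrix κ κ F ≃ₗ[F] Matrix (ι × κ) (ι × κ) F :=
    (kroneckerTMulLinearEquiv ι ι κ κ F F F F).trans (TensorProduct.lid F F).mapMatrix
  let e' : SkewMatrix c ⊗[F] SkewMatrix d ≃ₗ[F] SkewMatrix (c.tensor d) := e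
  have he (x : SkewMatrix c) (y : SkewMatrix d) (p q) :
      e' (x ⊗ₜ y) p q = x p.1 q.1 * y p.2 q.2 := by
    change e ((x : Matrix ι ι F) ⊗ₜ (y : Matrix κ κ F)) p q = _
    simp [e]
    rfl
  refine ⟨e', IsAlgIso.map_mul_of_tmul e' fun a b a' b' => ?_⟩
  ext p q
  rw [he, SkewMatrix.mul_apply, SkewMatrix.mul_apply, SkewMatrix.mul_apply, Finset.sum_mul_sum,
    Fintype.sum_prod_type]
  refine Finset.sum_congr rfl fun i _ => Finset.sum_congr rfl fun j _ => ?_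
  rw [he, he]
  simp only [tensor]
  ring

/-- The trivial skew set of degree one. -/
def unit (F : Type u) [Field F] : SkewSet F (Fin 1) where
  coeff _ _ _ := 1
  left_one _ _ := rfl
  right_one _ _ := rfl

end SkewSet

namespace IsSkewEquivalent

variable {F}
variable {A A' B B' C : Type*}
  [NonAssocRing A] [Module F A] [SMulCommClass F A A] [IsScalarTower F A A]
  [NonAssocRing A'] [Module F A'] [SMulCommClass F A' A'] [IsScalarTower F A' A']
  [NonAssocRing B] [Module F B] [SMulCommClass F B B] [IsScalarTower F B B]
  [NonAssocRing B'] [Module F B'] [SMulCommClass F B' B'] [IsScalarTower F B' B']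
  [NonAssocRing C] [Module F C] [SMulCommClass F C C] [IsScalarTower F C C]

theorem of_iso (h : IsAlgIso F A B) : IsSkewEquivalent F A B :=
  ⟨1, 1, SkewSet.unit F, SkewSet.unit F, one_pos, one_pos, h.tensor .refl⟩

theorem symm (h : IsSkewEquivalent F A B) : IsSkewEquivalent F B A := by
  obtain ⟨n, n', c, c', hn, hn', e⟩ := h
  exact ⟨n', n, c', c, hn', hn, e.symm⟩

theorem exists_tensor {n m : ℕ} (c : SkewSet F (Fin n)) (d : SkewSet F (Fin m)) :
    ∃ s : SkewSet F (Fin (n * m)), IsAlgIso F (SkewMatrix c ⊗[F] SkewMatrix d) (SkewMatrix s) :=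
  ⟨(c.tensor d).reindex finProdFinEquiv.symm, (c.tensor_iso d).trans (SkewSet.reindex_iso _ _)⟩

theorem trans (h : IsSkewEquivalent F A B) (h' : IsSkewEquivalent F B C) :
    IsSkewEquivalent F A C := by
  obtain ⟨n, n', c, c', hn, hn', e⟩ := h
  obtain ⟨m, m', d, d', hm, hm', e'⟩ := h'
  obtain ⟨s, hs⟩ := exists_tensor c d
  obtain ⟨s', hs'⟩ := exists_tensor d' c'
  refine ⟨_, _, s, s', Nat.mul_pos hn hm, Nat.mul_pos hm' hn', ?_⟩
  have h1 : IsAlgIso F (A ⊗[F] SkewMatrix s) ((A ⊗[F] SkewMatrix c) ⊗[F] SkewMatrix d) :=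
    (IsAlgIso.refl.tensor hs.symm).trans IsAlgIso.assoc.symm
  have h2 : IsAlgIso F ((A ⊗[F] SkewMatrix c) ⊗[F] SkewMatrix d)
      ((B ⊗[F] SkewMatrix c') ⊗[F] SkewMatrix d) := e.tensor .refl
  have h3 : IsAlgIso F ((B ⊗[F] SkewMatrix c') ⊗[F] SkewMatrix d)
      (B ⊗[F] (SkewMatrix d ⊗[F] SkewMatrix c')) :=
    IsAlgIso.assoc.trans (IsAlgIso.refl.tensor IsAlgIso.comm)
  have h4 : IsAlgIso F (B ⊗[F] (SkewMatrix d ⊗[F] SkewMatrix c'))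
      ((B ⊗[F] SkewMatrix d) ⊗[F] SkewMatrix c') := IsAlgIso.assoc.symm
  have h5 : IsAlgIso F ((B ⊗[F] SkewMatrix d) ⊗[F] SkewMatrix c')
      ((C ⊗[F] SkewMatrix d') ⊗[F] SkewMatrix c') := e'.tensor .refl
  have h6 : IsAlgIso F ((C ⊗[F] SkewMatrix d') ⊗[F] SkewMatrix c') (C ⊗[F] SkewMatrix s') :=
    IsAlgIso.assoc.trans (IsAlgIso.refl.tensor hs')
  exact h1.trans (h2.trans (h3.trans (h4.trans (h5.trans h6))))

theorem tensor (h : IsSkewEquivalent F A A') (h' : IsSkewEquivalent F B B') :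
    IsSkewEquivalent F (A ⊗[F] B) (A' ⊗[F] B') := by
  obtain ⟨n, n', c, c', hn, hn', e⟩ := h
  obtain ⟨m, m', d, d', hm, hm', e'⟩ := h'
  obtain ⟨s, hs⟩ := exists_tensor c d
  obtain ⟨s', hs'⟩ := exists_tensor c' d'
  refine ⟨_, _, s, s', Nat.mul_pos hn hm, Nat.mul_pos hn' hm', ?_⟩
  have h1 : IsAlgIso F ((A ⊗[F] B) ⊗[F] SkewMatrix s)
      ((A ⊗[F] SkewMatrix c) ⊗[F] (B ⊗[F] SkewMatrix d)) :=
    (IsAlgIso.refl.tensor hs.symm).trans IsAlgIso.tensorComm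
  have h2 : IsAlgIso F ((A' ⊗[F] B') ⊗[F] SkewMatrix s')
      ((A' ⊗[F] SkewMatrix c') ⊗[F] (B' ⊗[F] SkewMatrix d')) :=
    (IsAlgIso.refl.tensor hs'.symm).trans IsAlgIso.tensorComm
  exact h1.trans ((e.tensor e').trans h2.symm)

end IsSkewEquivalent

end Iso

/-! ## Minimally faithful modules -/

/-- A module is minimally faithful if it is faithful and none of its proper sections (quotients of
submodules) is faithful. -/
def IsMinimallyFaithful (R : Type*) (M : Type*) [Ring R] [AddCommGroup M] [Module R M] : Prop :=
  FaithfulSMul R M ∧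
    ∀ (N : Submodule R M) (P : Submodule R N), FaithfulSMul R (N ⧸ P) → N = ⊤ ∧ P = ⊥

section MinimallyFaithful

variable {R M : Type*} [CommRing R] [AddCommGroup M] [Module R M]

theorem exists_smul_injective [IsArtinianRing R] [IsReduced R] [FaithfulSMul R M] :
    ∃ v : M, Function.Injective fun r : R => r • v := by
  classical
  have := Fintype.ofFinite (MaximalSpectrum R)
  let E := IsArtinianRing.equivPi R
  let e : MaximalSpectrum R → R := fun m => E.symm (Pi.single m 1)
  have he (m) : E (e m) = Pi.single m 1 := E.apply_symm_apply _
  have hne (m) : ∃ v : M, e m • v ≠ 0 := by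
    by_contra! h
    have : e m = 0 := FaithfulSMul.eq_of_smul_eq_smul (α := M) fun v => by simp [h v]
    have h1 := congrFun ((he m).symm.trans (by rw [this, map_zero])) m
    rw [Pi.single_eq_same, Pi.zero_apply] at h1
    exact one_ne_zero h1
  choose v hv using hne
  have hmul (m m' : MaximalSpectrum R) : e m * e m' = if m = m' then e m else 0 := by
    apply E.injective
    rw [map_mul, he, he]
    split_ifs with h
    · subst h
      rw [he, ← Pi.single_mul, one_mul]
    · rw [map_zero]
      funext i
      by_cases hi : i = m
      · subst hi; simp [Pi.single_eq_of_ne h]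
      · simp [Pi.single_eq_of_ne hi]
  refine ⟨∑ m, e m • v m, fun r s hrs => sub_eq_zero.1 ?_⟩
  have h0 : (r - s) • ∑ m, e m • v m = 0 := by
    rw [sub_smul]; exact sub_eq_zero.2 hrs
  set t := r - s
  apply E.injective
  rw [map_zero]
  funext m
  by_contra hm
  rw [Pi.zero_apply] at hm
  have hem : t • e m • v m = 0 := by
    have h1 : e m • t • ∑ m, e m • v m = 0 := by rw [h0, smul_zero]
    rw [smul_comm, Finset.smul_sum] at h1
    simpa [smul_smul, hmul, ← mul_assoc] using h1
  let := Ideal.Quotient.field m.asIdeal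
  have hinv : e m = E.symm (Pi.single m (E t m)⁻¹) * (t * e m) := by
    apply E.injective
    rw [map_mul, map_mul, he, E.apply_symm_apply]
    funext m'
    by_cases h : m' = m
    · subst h
      simp only [Pi.mul_apply, Pi.single_eq_same, mul_one]
      exact (inv_mul_cancel₀ hm).symm
    · simp [Pi.single_eq_of_ne h]
  apply hv m
  rw [hinv, mul_smul, mul_smul, hem, smul_zero]

theorem isMinimallyFaithful_iff [IsArtinianRing R] [IsReduced R] :
    IsMinimallyFaithful R M ↔ ∃ v : M, Function.Bijective fun r : R => r • v := by
  constructor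
  · rintro ⟨hf, hmin⟩
    obtain ⟨v, hv⟩ := exists_smul_injective (R := R) (M := M)
    refine ⟨v, hv, ?_⟩
    have hN : FaithfulSMul R (R ∙ v ⧸ (⊥ : Submodule R (R ∙ v))) := by
      refine ⟨fun {r s} h => hv ?_⟩
      have h1 := h (Submodule.Quotient.mk ⟨v, Submodule.mem_span_singleton_self v⟩)
      rw [← Submodule.Quotient.mk_smul, ← Submodule.Quotient.mk_smul, Submodule.Quotient.eq,
        Submodule.mem_bot, sub_eq_zero] at h1
      exact congrArg Subtype.val h1
    have htop := (hmin _ _ hN).1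
    intro x
    have hx : x ∈ R ∙ v := htop ▸ Submodule.mem_top
    exact Submodule.mem_span_singleton.1 hx
  · rintro ⟨v, hinj, hsurj⟩
    refine ⟨⟨fun h => hinj (h v)⟩, fun N P hNP => ?_⟩
    have kill (r : R) (h : ∀ x : N, r • x ∈ P) : r = 0 := by
      refine hNP.eq_of_smul_eq_smul fun y => ?_
      obtain ⟨x, rfl⟩ := Submodule.Quotient.mk_surjective _ y
      rw [zero_smul, ← Submodule.Quotient.mk_smul, Submodule.Quotient.mk_eq_zero]
      exact h x
    let I : Ideal R := N.comap (LinearMap.toSpanSingleton R M v)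
    have hI (r : R) : r ∈ I ↔ r • v ∈ N := by
      simp [I, LinearMap.toSpanSingleton_apply]
    have : IsSemisimpleRing R := IsArtinianRing.isSemisimpleRing_of_isReduced R
    have : ComplementedLattice (Submodule R R) := this.toComplementedLattice
    obtain ⟨J, hJ⟩ : ∃ J : Submodule R R, IsCompl I J := exists_isCompl I
    have hJ0 : J = ⊥ := by
      rw [eq_bot_iff]
      intro j hj
      rw [Submodule.mem_bot]
      refine kill j fun x => ?_
      obtain ⟨r, hr⟩ := hsurj x
      have hrI : r ∈ I := (hI r).2 (by change r • v = x at hr; rw [hr]; exact x.2)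
      have : j * r ∈ I ⊓ J := ⟨I.mul_mem_left _ hrI, Ideal.mul_mem_right _ J hj⟩
      rw [hJ.inf_eq_bot, Submodule.mem_bot] at this
      have hx : j • x = 0 := by
        apply Subtype.ext
        change j • (x : M) = 0
        rw [← hr]
        change j • r • v = 0
        rw [smul_smul, this, zero_smul]
      rw [hx]; exact P.zero_mem
    have hItop : I = ⊤ := by simpa [hJ0] using hJ.sup_eq_top
    have hN : N = ⊤ := by
      rw [eq_top_iff]
      intro x _
      obtain ⟨r, rfl⟩ := hsurj x
      exact (hI r).1 (hItop ▸ Submodule.mem_top)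
    refine ⟨hN, ?_⟩
    rw [eq_bot_iff]
    intro p hp
    obtain ⟨r, hr⟩ := hsurj p
    change r • v = p at hr
    have hr0 : r = 0 := by
      refine kill r fun x => ?_
      obtain ⟨s, hs⟩ := hsurj x
      have : r • x = s • p := by
        apply Subtype.ext
        change r • (x : M) = s • (p : M)
        rw [← hs, ← hr]
        exact smul_comm r s v
      rw [this]
      exact P.smul_mem s hp
    rw [Submodule.mem_bot]
    apply Subtype.ext
    rw [← hr, hr0, zero_smul]; rfl

end MinimallyFaithful

/-! ## Semiassociative algebras -/

/-- The nucleus: elements `x` with `(x, A, A) = (A, x, A) = (A, A, x) = 0`. -/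
def nucleus (A : Type*) [NonUnitalNonAssocRing A] : Set A :=
  {x | ∀ a b : A, associator x a b = 0 ∧ associator a x b = 0 ∧ associator a b x = 0}

/-- An embedding of the unital algebra `K` as a subalgebra of the nucleus of `A`. -/
structure NuclearEmbedding (F : Type*) (K : Type*) (A : Type*) [Field F] [CommRing K] [Algebra F K]
    [NonAssocRing A] [Module F A] where
  toLinearMap : K →ₗ[F] A
  map_one : toLinearMap 1 = 1
  map_mul : ∀ k l, toLinearMap (k * l) = toLinearMap k * toLinearMap l
  injective : Function.Injective toLinearMap
  mem_nucleus : ∀ k, toLinearMap k ∈ nucleus A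

namespace NuclearEmbedding

variable {F K A : Type*} [Field F] [CommRing K] [Algebra F K] [NonAssocRing A] [Module F A]

instance : FunLike (NuclearEmbedding F K A) K A where
  coe φ := φ.toLinearMap
  coe_injective φ ψ h := by
    cases φ; cases ψ; congr; exact DFunLike.coe_injective h

variable (φ : NuclearEmbedding F K A)

theorem mul_assoc_left (k : K) (a b : A) : φ k * a * b = φ k * (a * b) :=
  sub_eq_zero.1 (φ.mem_nucleus k a b).1

theorem mul_assoc_mid (k : K) (a b : A) : a * φ k * b = a * (φ k * b) :=
  sub_eq_zero.1 (φ.mem_nucleus k a b).2.1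

theorem mul_assoc_right (k : K) (a b : A) : a * b * φ k = a * (b * φ k) :=
  sub_eq_zero.1 (φ.mem_nucleus k a b).2.2

variable [SMulCommClass F A A] [IsScalarTower F A A]

/-- `k` acts by `a ↦ k * a`. -/
def leftAction : K →ₐ[F] Module.End F A :=
  AlgHom.ofLinearMap ((LinearMap.mul F A).comp φ.toLinearMap)
    (by ext a; simp [φ.map_one])
    (fun k l => by
      ext a
      simp only [LinearMap.comp_apply, φ.map_mul, LinearMap.mul_apply', Module.End.mul_apply]
      exact φ.mul_assoc_left k _ a)

/-- `k` acts by `a ↦ a * k`. -/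
def rightAction : K →ₐ[F] Module.End F A :=
  AlgHom.ofLinearMap ((LinearMap.mul F A).flip.comp φ.toLinearMap)
    (by ext a; simp [φ.map_one])
    (fun k l => by
      ext a
      rw [mul_comm k l]
      simp only [LinearMap.comp_apply, φ.map_mul, LinearMap.mul_apply', Module.End.mul_apply,
        LinearMap.flip_apply]
      exact (φ.mul_assoc_mid l a _).symm)

theorem commute_actions (k l : K) : Commute (φ.leftAction k) (φ.rightAction l) :=
  LinearMap.ext fun a => (φ.mul_assoc_left k a (φ l)).symm

/-- The action `(k ⊗ l) a = k a l` of `K ⊗ K` on `A`. -/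
noncomputable def biAction : K ⊗[F] K →ₐ[F] Module.End F A :=
  Algebra.TensorProduct.lift φ.leftAction φ.rightAction φ.commute_actions

theorem biAction_tmul (k l : K) (a : A) : φ.biAction (k ⊗ₜ l) a = φ k * (a * φ l) := by
  rw [biAction, Algebra.TensorProduct.lift_tmul]
  rfl

/-- `A` as a module over `K ⊗ K`. -/
noncomputable abbrev bimodule : Module (K ⊗[F] K) A :=
  Module.compHom A φ.biAction.toRingHom

end NuclearEmbedding

/-- A semiassociative algebra over `F`: finite dimensional, with center `F`, and minimally
faithful over `K ⊗ K` for some étale subalgebra `K` of the nucleus. -/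
structure IsSemiassociative (F : Type u) (A : Type v) [Field F] [NonAssocRing A] [Module F A]
    [SMulCommClass F A A] [IsScalarTower F A A] : Prop where
  finite : Module.Finite F A
  nontrivial : Nontrivial A
  center_eq : Set.center A = Set.range fun r : F => r • (1 : A)
  exists_etale : ∃ (K : Type v) (_ : CommRing K) (_ : Algebra F K) (_ : Algebra.Etale F K)
    (φ : NuclearEmbedding F K A),
    @IsMinimallyFaithful (K ⊗[F] K) A _ _ φ.bimodule

section Semiassociative

variable {F : Type u} [Field F]

theorem etale_tensor (K L : Type*) [CommRing K] [Algebra F K] [CommRing L] [Algebra F L]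
    [Algebra.Etale F K] [Algebra.Etale F L] : Algebra.Etale F (K ⊗[F] L) :=
  Algebra.Etale.comp F K (K ⊗[F] L)

theorem minimallyFaithful_iff_of_etale {K A : Type*} [CommRing K] [Algebra F K] [Algebra.Etale F K]
    [NonAssocRing A] [Module F A] [SMulCommClass F A A] [IsScalarTower F A A]
    (φ : NuclearEmbedding F K A) :
    @IsMinimallyFaithful (K ⊗[F] K) A _ _ φ.bimodule ↔
      ∃ v : A, Function.Bijective fun r : K ⊗[F] K => φ.biAction r v := by
  have := etale_tensor (F := F) K K
  have : Module.Finite F (K ⊗[F] K) := Algebra.FormallyUnramified.finite_of_free F _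
  have : IsReduced (K ⊗[F] K) := Algebra.FormallyUnramified.isReduced_of_field F _
  have : IsArtinianRing (K ⊗[F] K) := IsArtinianRing.of_finite F _
  let := φ.bimodule
  exact isMinimallyFaithful_iff (R := K ⊗[F] K) (M := A)

variable {A B : Type*}
  [NonAssocRing A] [Module F A] [SMulCommClass F A A] [IsScalarTower F A A]
  [NonAssocRing B] [Module F B] [SMulCommClass F B B] [IsScalarTower F B B]

theorem smul_one_mem_center (r : F) : r • (1 : A) ∈ Set.center A := by
  rw [Set.mem_center_iff]
  refine ⟨fun a => ?_, fun a b => ?_, fun a b => ?_⟩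
  · simp [Commute, SemiconjBy]
  · simp [smul_mul_assoc]
  · simp [mul_smul_comm]

theorem IsSemiassociative.self : IsSemiassociative F F where
  finite := inferInstance
  nontrivial := inferInstance
  center_eq := by
    apply Set.Subset.antisymm
    · intro z _; exact ⟨z, by simp⟩
    · rintro _ ⟨r, rfl⟩; exact smul_one_mem_center r
  exists_etale := by
    let φ : NuclearEmbedding F F F :=
      { toLinearMap := LinearMap.id
        map_one := rfl
        map_mul := fun _ _ => rfl
        injective := fun _ _ h => h
        mem_nucleus := fun k a b => by simp [associator, mul_assoc] }
    refine ⟨F, inferInstance, inferInstance, inferInstance, φ, ?_⟩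
    refine (minimallyFaithful_iff_of_etale φ).2 ⟨1, ?_⟩
    convert (TensorProduct.lid F F).bijective using 1
    funext r
    induction r with
    | zero => simp
    | add x y hx hy => simp [hx, hy]
    | tmul k l => rw [φ.biAction_tmul]; simp; rfl

theorem center_tensor (hA : Set.center A ⊆ Set.range fun r : F => r • (1 : A))
    (hB : Set.center B ⊆ Set.range fun r : F => r • (1 : B)) [Nontrivial A] :
    Set.center (A ⊗[F] B) ⊆ Set.range fun r : F => r • (1 : A ⊗[F] B) := by
  classical
  intro z hz
  rw [Set.mem_center_iff] at hz
  let b := Module.Free.chooseBasis F B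
  let E := TensorProduct.equivFinsuppOfBasisRight (M := A) b
  have hE (a : A) (y : B) (i) : E (a ⊗ₜ y) i = b.repr y i • a := by
    simp [E, TensorProduct.equivFinsuppOfBasisRight_apply_tmul]
  have hr (x : A ⊗[F] B) (a : A) (i) : E (x * (a ⊗ₜ 1)) i = E x i * a := by
    induction x with
    | zero => simp
    | add x y hx hy => simp [add_mul, hx, hy]
    | tmul a' y => simp [hE, smul_mul_assoc]
  have hl (x : A ⊗[F] B) (a : A) (i) : E ((a ⊗ₜ 1) * x) i = a * E x i := by
    induction x with
    | zero => simp
    | add x y hx hy => simp [mul_add, hx, hy]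
    | tmul a' y => simp [hE, mul_smul_comm]
  have hcent (i) : E z i ∈ Set.center A := by
    rw [Set.mem_center_iff]
    refine ⟨fun a => ?_, fun a a' => ?_, fun a a' => ?_⟩
    · have h := hz.comm (a ⊗ₜ 1)
      have h1 := congrArg (fun y => E y i) h.eq
      rw [commute_iff_eq]
      simpa only [hr, hl] using h1
    · have h := hz.left_assoc (a ⊗ₜ 1) (a' ⊗ₜ 1)
      rw [Algebra.TensorProduct.tmul_mul_tmul, one_mul] at h
      have h1 := congrArg (fun y => E y i) h
      simpa only [hr, hl] using h1
    · have h := hz.right_assoc (a ⊗ₜ 1) (a' ⊗ₜ 1)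
      rw [Algebra.TensorProduct.tmul_mul_tmul, one_mul] at h
      have h1 := congrArg (fun y => E y i) h
      simpa only [hr, hl] using h1
  choose f hf using fun i => hA (hcent i)
  -- `z = 1 ⊗ y`
  obtain ⟨y, hy⟩ : ∃ y : B, z = 1 ⊗ₜ y := by
    refine ⟨∑ i ∈ (E z).support, f i • b i, E.injective (Finsupp.ext fun i => ?_)⟩
    rw [hE, ← hf i]
    simp only [map_sum, map_smul, Module.Basis.repr_self, Finsupp.coe_finsetSum,
      Finset.sum_apply, Finsupp.smul_apply, Finsupp.single_apply, smul_eq_mul, mul_ite, mul_one,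
      mul_zero, Finset.sum_ite_eq']
    split_ifs with h
    · rfl
    · rw [zero_smul, ← Finsupp.notMem_support_iff.1 h]
      exact hf i
  have hinj : Function.Injective fun y : B => (1 : A) ⊗ₜ[F] y := by
    intro y y' h
    apply b.repr.injective
    ext i
    have h1 := congrArg (fun t => E t i) h
    simp only [hE] at h1
    exact smul_left_injective F (one_ne_zero : (1 : A) ≠ 0) h1
  subst hy
  have hyc : y ∈ Set.center B := by
    rw [Set.mem_center_iff]
    refine ⟨fun a => hinj ?_, fun a a' => hinj ?_, fun a a' => hinj ?_⟩
    · simpa using (hz.comm (1 ⊗ₜ a)).eq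
    · simpa using hz.left_assoc (1 ⊗ₜ a) (1 ⊗ₜ a')
    · simpa using hz.right_assoc (1 ⊗ₜ a) (1 ⊗ₜ a')
  obtain ⟨r, rfl⟩ := hB hyc
  exact ⟨r, by simp [Algebra.TensorProduct.one_def]⟩

theorem NuclearEmbedding.tmul_mem_nucleus {x : A} {y : B} (hx : x ∈ nucleus A)
    (hy : y ∈ nucleus B) : x ⊗ₜ[F] y ∈ nucleus (A ⊗[F] B) := by
  have hx1 (a b) : x * a * b = x * (a * b) := sub_eq_zero.1 (hx a b).1
  have hx2 (a b) : a * x * b = a * (x * b) := sub_eq_zero.1 (hx a b).2.1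
  have hx3 (a b) : a * b * x = a * (b * x) := sub_eq_zero.1 (hx a b).2.2
  have hy1 (a b) : y * a * b = y * (a * b) := sub_eq_zero.1 (hy a b).1
  have hy2 (a b) : a * y * b = a * (y * b) := sub_eq_zero.1 (hy a b).2.1
  have hy3 (a b) : a * b * y = a * (b * y) := sub_eq_zero.1 (hy a b).2.2
  intro s t
  simp only [associator_apply, sub_eq_zero]
  induction s with
  | zero => simp
  | add s s' h h' => simp [mul_add, add_mul, h, h']
  | tmul a b =>
    induction t with
    | zero => simp
    | add s s' h h' =>
      exact ⟨by rw [mul_add, mul_add, mul_add, h.1, h'.1],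
        by rw [mul_add, mul_add, mul_add, h.2.1, h'.2.1],
        by rw [mul_add, add_mul, add_mul, mul_add, h.2.2, h'.2.2]⟩
    | tmul a' b' => simp [hx1, hx2, hx3, hy1, hy2, hy3]

theorem nucleus_add {x y : A} (hx : x ∈ nucleus A) (hy : y ∈ nucleus A) : x + y ∈ nucleus A := by
  intro a b
  obtain ⟨h1, h2, h3⟩ := hx a b
  obtain ⟨g1, g2, g3⟩ := hy a b
  simp only [associator_apply, sub_eq_zero] at *
  simp [mul_add, add_mul, *]

/-- Tensor product of embeddings into the nuclei. -/
noncomputable def NuclearEmbedding.tensor {K L : Type*} [CommRing K] [Algebra F K] [CommRing L]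
    [Algebra F L] (φ : NuclearEmbedding F K A) (ψ : NuclearEmbedding F L B) :
    NuclearEmbedding F (K ⊗[F] L) (A ⊗[F] B) where
  toLinearMap := TensorProduct.map φ.toLinearMap ψ.toLinearMap
  map_one := by simp [Algebra.TensorProduct.one_def, φ.map_one, ψ.map_one]
  map_mul x y := by
    induction x with
    | zero => simp
    | add s s' h h' => simp [add_mul, h, h']
    | tmul a b =>
      induction y with
      | zero => simp
      | add s s' h h' => simp [mul_add, h, h']
      | tmul a' b' => simp [φ.map_mul, ψ.map_mul]
  injective := by
    have h1 : Function.Injective (φ.toLinearMap.rTensor L) :=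
      Module.Flat.rTensor_preserves_injective_linearMap _ φ.injective
    have h2 : Function.Injective (ψ.toLinearMap.lTensor A) :=
      Module.Flat.lTensor_preserves_injective_linearMap _ ψ.injective
    have : TensorProduct.map φ.toLinearMap ψ.toLinearMap =
        (ψ.toLinearMap.lTensor A).comp (φ.toLinearMap.rTensor L) :=
      (LinearMap.lTensor_comp_rTensor _ _ _).symm
    rw [this]
    exact h2.comp h1
  mem_nucleus x := by
    induction x with
    | zero => intro a b; simp [associator_apply]
    | add s s' h h' => rw [map_add]; exact nucleus_add h h'
    | tmul k l => exact tmul_mem_nucleus (φ.mem_nucleus k) (ψ.mem_nucleus l)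

end Semiassociative

theorem IsSemiassociative.tensor {F : Type u} {A B : Type v} [Field F]
    [NonAssocRing A] [Module F A] [SMulCommClass F A A] [IsScalarTower F A A]
    [NonAssocRing B] [Module F B] [SMulCommClass F B B] [IsScalarTower F B B]
    (hA : IsSemiassociative F A) (hB : IsSemiassociative F B) :
    IsSemiassociative F (A ⊗[F] B) := by
  obtain ⟨fA, nA, cA, K, _, _, _, φ, hφ⟩ := hA
  obtain ⟨fB, nB, cB, L, _, _, _, ψ, hψ⟩ := hB
  refine ⟨inferInstance, inferInstance, ?_, K ⊗[F] L, inferInstance, inferInstance,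
    etale_tensor K L, φ.tensor ψ, ?_⟩
  · apply Set.Subset.antisymm
    · exact center_tensor cA.subset cB.subset
    · rintro _ ⟨r, rfl⟩; exact smul_one_mem_center r
  · have := etale_tensor (F := F) K L
    obtain ⟨v, hv⟩ := (minimallyFaithful_iff_of_etale φ).1 hφ
    obtain ⟨w, hw⟩ := (minimallyFaithful_iff_of_etale ψ).1 hψ
    refine (minimallyFaithful_iff_of_etale (φ.tensor ψ)).2 ⟨v ⊗ₜ w, ?_⟩
    let e : K ⊗[F] K ≃ₗ[F] A :=
      LinearEquiv.ofBijective ((LinearMap.applyₗ v).comp φ.biAction.toLinearMap) hv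
    let f : L ⊗[F] L ≃ₗ[F] B :=
      LinearEquiv.ofBijective ((LinearMap.applyₗ w).comp ψ.biAction.toLinearMap) hw
    let g := (TensorProduct.tensorTensorTensorComm F K L K L).trans (TensorProduct.congr e f)
    convert g.bijective using 1
    funext r
    have key : ((LinearMap.applyₗ (v ⊗ₜ w)).comp (φ.tensor ψ).biAction.toLinearMap) =
        g.toLinearMap := by
      ext k l k' l'
      change (φ.tensor ψ).biAction ((k ⊗ₜ l) ⊗ₜ (k' ⊗ₜ l')) (v ⊗ₜ w) =
        φ.biAction (k ⊗ₜ k') v ⊗ₜ ψ.biAction (l ⊗ₜ l') w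
      rw [NuclearEmbedding.biAction_tmul, NuclearEmbedding.biAction_tmul,
        NuclearEmbedding.biAction_tmul]
      change (φ k ⊗ₜ ψ l) * ((v ⊗ₜ w) * (φ k' ⊗ₜ ψ l')) = _
      simp
    exact LinearMap.congr_fun key r

/-! ## The semiassociative Brauer monoid -/

/-- The semiassociative algebras over `F`. -/
structure SemiassocAlg (F : Type u) [Field F] where
  carrier : Type u
  [ring : NonAssocRing carrier]
  [module : Module F carrier]
  [smulComm : SMulCommClass F carrier carrier]
  [tower : IsScalarTower F carrier carrier]
  isSemiassociative : IsSemiassociative F carrier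

namespace SemiassocAlg

instance (F : Type u) [Field F] : CoeSort (SemiassocAlg F) (Type u) := ⟨SemiassocAlg.carrier⟩

attribute [instance] ring module smulComm tower

variable (F : Type u) [Field F]

/-- Brauer equivalence of semiassociative algebras. -/
instance setoid : Setoid (SemiassocAlg F) where
  r A B := IsSkewEquivalent F A B
  iseqv :=
    { refl := fun _ => .of_iso .refl
      symm := fun h => h.symm
      trans := fun h h' => h.trans h' }

variable {F}

/-- The tensor product of semiassociative algebras. -/
noncomputable def tensor (A B : SemiassocAlg F) : SemiassocAlg F where
  carrier := A ⊗[F] B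
  isSemiassociative := A.isSemiassociative.tensor B.isSemiassociative

variable (F)

/-- The field `F` as a semiassociative algebra over itself. -/
def unit : SemiassocAlg F where
  carrier := F
  isSemiassociative := .self

end SemiassocAlg

/-- The semiassociative Brauer monoid. -/
def SemiassocBrauerMonoid (F : Type u) [Field F] : Type (u + 1) :=
  Quotient (SemiassocAlg.setoid F)

namespace SemiassocBrauerMonoid

variable {F : Type u} [Field F]

/-- The class of a semiassociative algebra. -/
def mk (A : SemiassocAlg F) : SemiassocBrauerMonoid F :=
  Quotient.mk (SemiassocAlg.setoid F) A

/-- The product is induced by the tensor product, and the identity is the class of `F`. -/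
noncomputable instance : CommMonoid (SemiassocBrauerMonoid F) where
  mul := Quotient.map₂ SemiassocAlg.tensor fun _ _ h _ _ h' => IsSkewEquivalent.tensor h h'
  one := mk (SemiassocAlg.unit F)
  mul_assoc := by
    rintro ⟨A⟩ ⟨B⟩ ⟨C⟩
    exact Quotient.sound (.of_iso (IsAlgIso.assoc (A := A) (B := B) (C := C)))
  one_mul := by
    rintro ⟨A⟩
    exact Quotient.sound (.of_iso (IsAlgIso.lid (A := A)))
  mul_one := by
    rintro ⟨A⟩
    exact Quotient.sound (.of_iso (IsAlgIso.comm.trans (IsAlgIso.lid (A := A))))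
  mul_comm := by
    rintro ⟨A⟩ ⟨B⟩
    exact Quotient.sound (.of_iso (IsAlgIso.comm (A := A) (B := B)))

end SemiassocBrauerMonoid

/-! ## The classical Brauer group as a monoid -/

section Classical

variable {F : Type u} [Field F]

theorem one_mem_span_of_ne_zero {A : Type*} [Ring A] [IsSimpleRing A] {a : A} (ha : a ≠ 0)
    {p : A → Prop} (h0 : p 0) (hadd : ∀ x y, p x → p y → p (x + y))
    (hmul : ∀ s t, p (s * a * t)) : p 1 := by
  let H : AddSubgroup A := AddSubgroup.closure {y | ∃ s t, y = s * a * t}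
  let I : TwoSidedIdeal A := TwoSidedIdeal.mk' {x | x ∈ H}
    H.zero_mem (fun h h' => H.add_mem h h') (fun h => H.neg_mem h)
    (fun {x y} hy => by
      refine AddSubgroup.closure_induction (p := fun y _ => x * y ∈ AddSubgroup.closure _)
        ?_ ?_ ?_ ?_ hy
      · rintro _ ⟨s, t, rfl⟩
        exact AddSubgroup.subset_closure ⟨x * s, t, by simp [mul_assoc]⟩
      · rw [mul_zero]; exact AddSubgroup.zero_mem _
      · intro _ _ _ _ h h'; rw [mul_add]; exact AddSubgroup.add_mem _ h h'
      · intro _ _ h; rw [mul_neg]; exact AddSubgroup.neg_mem _ h)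
    (fun {y x} hy => by
      refine AddSubgroup.closure_induction (p := fun y _ => y * x ∈ AddSubgroup.closure _)
        ?_ ?_ ?_ ?_ hy
      · rintro _ ⟨s, t, rfl⟩
        exact AddSubgroup.subset_closure ⟨s, t * x, by simp [mul_assoc]⟩
      · rw [zero_mul]; exact AddSubgroup.zero_mem _
      · intro _ _ _ _ h h'; rw [add_mul]; exact AddSubgroup.add_mem _ h h'
      · intro _ _ h; rw [neg_mul]; exact AddSubgroup.neg_mem _ h)
  have hI (x : A) : x ∈ I ↔ x ∈ AddSubgroup.closure {y | ∃ s t, y = s * a * t} :=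
    TwoSidedIdeal.mem_mk' ..
  have haI : a ∈ I := (hI a).2 (AddSubgroup.subset_closure ⟨1, 1, by simp⟩)
  have htop : I = ⊤ := (eq_bot_or_eq_top I).resolve_left fun h => ha (by
    rw [h] at haI; exact (TwoSidedIdeal.mem_bot A).1 haI)
  have h1 : (1 : A) ∈ I := by rw [htop]; trivial
  suffices h : ∀ x ∈ AddSubgroup.closure {y | ∃ s t, y = s * a * t}, p x ∧ p (-x) from
    (h 1 ((hI 1).1 h1)).1
  intro x hx
  refine AddSubgroup.closure_induction (p := fun y _ => p y ∧ p (-y)) ?_ ?_ ?_ ?_ hx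
  · rintro _ ⟨s, t, rfl⟩
    refine ⟨hmul s t, ?_⟩
    have := hmul (-s) t
    simpa using this
  · simpa using h0
  · intro x y _ _ h h'
    refine ⟨hadd _ _ h.1 h'.1, ?_⟩
    rw [neg_add]
    exact hadd _ _ h.2 h'.2
  · intro x _ h
    exact ⟨h.2, by simpa using h.1⟩

theorem isSimpleRing_tensor (A B : Type*) [Ring A] [Algebra F A] [Ring B] [Algebra F B]
    [Algebra.IsCentral F A] [IsSimpleRing A] [IsSimpleRing B] : IsSimpleRing (A ⊗[F] B) := by
  classical
  have : Nontrivial (A ⊗[F] B) := inferInstance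
  refine IsSimpleRing.of_eq_bot_or_eq_top fun I => or_iff_not_imp_left.2 fun hI => ?_
  let b := Module.Free.chooseBasis F B
  let E := TensorProduct.equivFinsuppOfBasisRight (M := A) b
  have hE (a : A) (y : B) (i) : E (a ⊗ₜ y) i = b.repr y i • a := by
    simp [E, TensorProduct.equivFinsuppOfBasisRight_apply_tmul]
  have hr (x : A ⊗[F] B) (a : A) (i) : E (x * (a ⊗ₜ 1)) i = E x i * a := by
    induction x with
    | zero => simp
    | add x y hx hy => simp [add_mul, hx, hy]
    | tmul a' y => simp [hE]
  have hl (x : A ⊗[F] B) (a : A) (i) : E ((a ⊗ₜ 1) * x) i = a * E x i := by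
    induction x with
    | zero => simp
    | add x y hx hy => simp [mul_add, hx, hy]
    | tmul a' y => simp [hE]
  -- a nonzero element of minimal support
  obtain ⟨x₀, hx₀I, hx₀⟩ : ∃ x ∈ I, x ≠ 0 := by
    by_contra! h
    exact hI (eq_bot_iff.2 fun x hx => (TwoSidedIdeal.mem_bot _).2 (h x hx))
  obtain ⟨x, ⟨hxI, hx⟩, hmin⟩ := exists_minimalFor_of_wellFoundedLT
    (fun x : A ⊗[F] B => x ∈ I ∧ x ≠ 0) (fun x => (E x).support) ⟨x₀, hx₀I, hx₀⟩
  have hEx : E x ≠ 0 := fun h => hx (E.injective (h.trans (map_zero E).symm))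
  obtain ⟨j, hj⟩ := Finsupp.support_nonempty_iff.2 hEx
  -- normalise the coordinate `j` to `1`
  obtain ⟨z, hzI, hzs, hzj⟩ : ∃ z ∈ I, (E z).support ⊆ (E x).support ∧ E z j = 1 := by
    refine one_mem_span_of_ne_zero (Finsupp.mem_support_iff.1 hj)
      (p := fun a => ∃ z ∈ I, (E z).support ⊆ (E x).support ∧ E z j = a) ?_ ?_ ?_
    · exact ⟨0, I.zero_mem, by simp, by simp⟩
    · rintro _ _ ⟨z, hz, hs, rfl⟩ ⟨w, hw, ht, rfl⟩
      refine ⟨z + w, I.add_mem hz hw, ?_, by simp⟩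
      rw [map_add]
      exact Finsupp.support_add.trans (Finset.union_subset hs ht)
    · intro s t
      refine ⟨(s ⊗ₜ 1) * x * (t ⊗ₜ 1), I.mul_mem_right _ _ (I.mul_mem_left _ _ hxI), ?_, ?_⟩
      · intro i hi
        rw [Finsupp.mem_support_iff, hr, hl] at hi
        rw [Finsupp.mem_support_iff]
        intro h0
        exact hi (by simp [h0])
      · rw [hr, hl]
  have hcomm (a : A) : (a ⊗ₜ 1) * z = z * (a ⊗ₜ 1) := by
    by_contra hne
    have hwI : (a ⊗ₜ 1) * z - z * (a ⊗ₜ 1) ∈ I :=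
      I.sub_mem (I.mul_mem_left _ _ hzI) (I.mul_mem_right _ _ hzI)
    have hw (i) : E ((a ⊗ₜ 1) * z - z * (a ⊗ₜ 1)) i = a * E z i - E z i * a := by
      rw [map_sub, Finsupp.sub_apply, hr, hl]
    have hsub : (E ((a ⊗ₜ 1) * z - z * (a ⊗ₜ 1))).support ⊆ (E x).support := by
      intro i hi
      apply hzs
      rw [Finsupp.mem_support_iff, hw] at hi
      rw [Finsupp.mem_support_iff]
      intro h0
      exact hi (by simp [h0])
    have := hmin ⟨hwI, sub_ne_zero.2 hne⟩ hsub hj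
    rw [Finsupp.mem_support_iff, hw, hzj] at this
    exact this (by simp)
  have hcent (i) : ∃ r : F, r • (1 : A) = E z i := by
    have h : E z i ∈ Subalgebra.center F A := by
      rw [Subalgebra.mem_center_iff]
      intro a
      rw [← hl, ← hr, hcomm]
    rw [Algebra.IsCentral.center_eq_bot, Algebra.mem_bot] at h
    obtain ⟨r, hr⟩ := h
    exact ⟨r, by rw [← hr, Algebra.algebraMap_eq_smul_one]⟩
  choose f hf using hcent
  obtain ⟨y, hy⟩ : ∃ y : B, z = 1 ⊗ₜ y := by
    refine ⟨∑ i ∈ (E z).support, f i • b i, E.injective (Finsupp.ext fun i => ?_)⟩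
    rw [hE, ← hf i]
    simp only [map_sum, map_smul, Module.Basis.repr_self, Finsupp.coe_finsetSum,
      Finset.sum_apply, Finsupp.smul_apply, Finsupp.single_apply, smul_eq_mul, mul_ite, mul_one,
      mul_zero, Finset.sum_ite_eq']
    split_ifs with h
    · rfl
    · rw [zero_smul, ← Finsupp.notMem_support_iff.1 h]
      exact hf i
  have hy0 : y ≠ 0 := by
    rintro rfl
    rw [hy] at hzj
    simp at hzj
  have h1 : (1 : A) ⊗ₜ[F] (1 : B) ∈ I := by
    refine one_mem_span_of_ne_zero hy0 (p := fun t => (1 : A) ⊗ₜ[F] t ∈ I) ?_ ?_ ?_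
    · simp [I.zero_mem]
    · intro s t hs ht
      rw [TensorProduct.tmul_add]; exact I.add_mem hs ht
    · intro s t
      have := I.mul_mem_right _ (1 ⊗ₜ t) (I.mul_mem_left (1 ⊗ₜ s) _ hzI)
      rw [hy] at this
      simpa using this
  rw [eq_top_iff]
  intro t _
  have := I.mul_mem_left t _ h1
  rwa [← Algebra.TensorProduct.one_def, mul_one] at this

theorem center_subset (A : Type*) [Ring A] [Algebra F A] [h : Algebra.IsCentral F A] :
    Set.center A ⊆ Set.range fun r : F => r • (1 : A) := by
  intro x hx
  obtain ⟨r, hr⟩ := Algebra.mem_bot.1 (h.out (show x ∈ Subalgebra.center F A from hx))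
  exact ⟨r, by rw [← hr, Algebra.algebraMap_eq_smul_one]⟩

theorem isCentral_tensor (A B : Type*) [Ring A] [Algebra F A] [Ring B] [Algebra F B]
    [Algebra.IsCentral F A] [Algebra.IsCentral F B] [Nontrivial A] :
    Algebra.IsCentral F (A ⊗[F] B) := by
  refine ⟨fun x hx => ?_⟩
  obtain ⟨r, hr⟩ := center_tensor (F := F) (A := A) (B := B) (center_subset A) (center_subset B)
    (show x ∈ Set.center (A ⊗[F] B) from hx)
  exact Algebra.mem_bot.2 ⟨r, by rw [← hr, Algebra.algebraMap_eq_smul_one]⟩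

end Classical

namespace CSA

variable {F : Type u} [Field F]

/-- The tensor product of central simple algebras. -/
noncomputable def tensor (A B : CSA.{u, u} F) : CSA.{u, u} F :=
  haveI := isSimpleRing_tensor (F := F) A B
  haveI := isCentral_tensor (F := F) A B
  { AlgCat.of F (A ⊗[F] B) with
    isCentral := ‹_›
    isSimple := ‹_›
    fin_dim := inferInstanceAs (FiniteDimensional F (A ⊗[F] B)) }

/-- The field `F` as a central simple algebra over itself. -/
def unit (F : Type u) [Field F] : CSA.{u, u} F where
  toAlgCat := AlgCat.of F F
  isCentral := inferInstanceAs (Algebra.IsCentral F F)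
  isSimple := inferInstanceAs (IsSimpleRing F)
  fin_dim := inferInstanceAs (FiniteDimensional F F)

theorem equivalent_of_algEquiv {A B : CSA.{u, u} F} (e : A ≃ₐ[F] B) : IsBrauerEquivalent A B :=
  ⟨1, 1, one_ne_zero, one_ne_zero, ⟨e.mapMatrix⟩⟩

theorem tensor_equivalent {A A' B B' : CSA.{u, u} F} (h : IsBrauerEquivalent A A')
    (h' : IsBrauerEquivalent B B') : IsBrauerEquivalent (A.tensor B) (A'.tensor B') := by
  obtain ⟨n, n', hn, hn', ⟨e⟩⟩ := h
  obtain ⟨m, m', hm, hm', ⟨f⟩⟩ := h'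
  have key (C D : CSA.{u, u} F) (k l : ℕ) :
      Nonempty (Matrix (Fin (k * l)) (Fin (k * l)) (C ⊗[F] D) ≃ₐ[F]
        Matrix (Fin k) (Fin k) C ⊗[F] Matrix (Fin l) (Fin l) D) :=
    ⟨(Matrix.reindexAlgEquiv F _ finProdFinEquiv.symm).trans
      (Matrix.kroneckerTMulAlgEquiv (Fin k) (Fin l) F F C D).symm⟩
  obtain ⟨g⟩ := key A B n m
  obtain ⟨g'⟩ := key A' B' n' m'
  exact ⟨n * m, n' * m', Nat.mul_ne_zero hn hm, Nat.mul_ne_zero hn' hm',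
    ⟨g.trans ((Algebra.TensorProduct.congr e f).trans g'.symm)⟩⟩

end CSA

/-- The classical Brauer group as a monoid: the product is induced by the tensor product, and the
identity is the class of `F`. -/
noncomputable instance BrauerGroup.instCommMonoid (F : Type u) [Field F] :
    CommMonoid (BrauerGroup.{u, u} F) where
  mul := Quotient.map₂ CSA.tensor fun _ _ h _ _ h' => CSA.tensor_equivalent h h'
  one := Quotient.mk _ (CSA.unit F)
  mul_assoc := by
    rintro ⟨A⟩ ⟨B⟩ ⟨C⟩
    exact Quotient.sound (CSA.equivalent_of_algEquiv (A := (A.tensor B).tensor C)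
      (B := A.tensor (B.tensor C)) (Algebra.TensorProduct.assoc F F F A B C))
  one_mul := by
    rintro ⟨A⟩
    exact Quotient.sound (CSA.equivalent_of_algEquiv (A := (CSA.unit F).tensor A)
      (Algebra.TensorProduct.lid F A))
  mul_one := by
    rintro ⟨A⟩
    exact Quotient.sound (CSA.equivalent_of_algEquiv (A := A.tensor (CSA.unit F))
      (Algebra.TensorProduct.rid F F A))
  mul_comm := by
    rintro ⟨A⟩ ⟨B⟩
    exact Quotient.sound (CSA.equivalent_of_algEquiv (A := A.tensor B) (B := B.tensor A)
      (Algebra.TensorProduct.comm F A B))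

/-! Skew equivalence implies Brauer equivalence because the nucleus of `A ⊗ M_n(F;c)` remembers `A`.
An isomorphism `A ⊗ M_n(F;c) ≅ B ⊗ M_{n'}(F;c')` identifies the two nuclei, which are associative
algebras. The nucleus contains `A ⊗ 1` and the idempotents `1 ⊗ e_ii`, hence splits into Peirce
pieces inside the spaces `A ⊗ e_ij`. Since `A` is simple, such a piece is either zero or all of `A ⊗
e_ij`, and in the second case it contains `1 ⊗ e_ij`. In a simple quotient `S` of the nucleus, the
images of these units that survive can be rescaled to genuine matrix units commuting with `A`, so `S
≅ M_k(A)` (`exists_algEquiv_matrix_of_peirce`, `exists_algEquiv_matrix_of_nucleus_surjective`). The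
same `S` is a simple quotient of the other nucleus, so `M_k(A) ≅ S ≅ M_l(B)`.

A central simple `A` is semiassociative as soon as it contains an étale `K` with `(dim K)² = dim A`.
Indeed `K ⊗ K` embeds in `A ⊗ Aᵐᵒᵖ`, which is simple and so acts faithfully on `A`. A faithful
module over the reduced Artinian ring `K ⊗ K` contains a free cyclic submodule, and equality of
dimensions makes it all of `A`; free of rank one is minimally faithful.

To find `K`, write `A ≅ M_n(D)` and take diagonal matrices over a separable subfield `L` of `D` with
`[L:F]² = [D:F]`. Such an `L` is a separable subfield of largest degree: the centralizer formula
shows that its centralizer `C` has center `L`, and if `C ≠ L`, Jacobson–Noether yields a separable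
element of `C` outside `L` that enlarges `L`.

Conversely, ordinary matrix algebras are skew matrix algebras, so the map on Brauer classes is well
defined; its injectivity is the first part. -/

/-! ## Matrix units -/

section MatrixUnits

variable {F A S ι : Type*} [Field F] [Ring A] [Algebra F A] [Ring S] [Algebra F S]
  [Fintype ι] [DecidableEq ι]

/-- A system of matrix units commuting with the image of `A` gives a homomorphism from the matrix
algebra over `A`. -/
theorem exists_algHom_matrix_of_matrixUnits (α : A →ₐ[F] S) (E : ι → ι → S)
    (hmul : ∀ i j k l, E i j * E k l = if j = k then E i l else 0) (hsum : ∑ i, E i i = 1)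
    (hcomm : ∀ a i j, α a * E i j = E i j * α a) :
    ∃ φ : Matrix ι ι A →ₐ[F] S, ∀ M, φ M = ∑ i, ∑ j, α (M i j) * E i j := by
  refine ⟨AlgHom.ofLinearMap
    { toFun := fun M => ∑ i, ∑ j, α (M i j) * E i j
      map_add' := fun M N => by simp [add_mul, Finset.sum_add_distrib]
      map_smul' := fun r M => by simp [Finset.smul_sum] } ?_ ?_, fun M => rfl⟩
  · simp only [LinearMap.coe_mk, AddHom.coe_mk, Matrix.one_apply]
    rw [← hsum]
    refine Finset.sum_congr rfl fun i _ => ?_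
    rw [Finset.sum_eq_single i]
    · simp
    · intro j _ hj
      simp [hj.symm]
    · simp
  · intro M N
    have hprod (i j k l) : α (M i j) * E i j * (α (N k l) * E k l) =
        if j = k then α (M i j * N k l) * E i l else 0 := by
      rw [mul_assoc, ← mul_assoc (E i j), ← hcomm, mul_assoc, hmul, map_mul, mul_assoc]
      split_ifs <;> simp
    simp only [LinearMap.coe_mk, AddHom.coe_mk, Finset.sum_mul]
    refine Finset.sum_congr rfl fun i _ => ?_
    simp only [Finset.mul_sum, hprod, Matrix.mul_apply, map_sum, Finset.sum_mul]
    rw [Finset.sum_comm]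
    refine Finset.sum_congr rfl fun j _ => ?_
    symm
    rw [Finset.sum_comm]
    simp

/-- A simple algebra with a Peirce decomposition whose pieces are generated over a simple algebra
`A` by elements commuting with `A` is a matrix algebra over `A`. -/
theorem exists_algEquiv_matrix_of_peirce [IsSimpleRing A] [IsSimpleRing S] (α : A →ₐ[F] S)
    (f : ι → ι → S) (hmul : ∀ i j l, ∃ r : F, f i j * f j l = r • f i l)
    (hleft : ∀ i j, f i i * f i j = f i j) (hright : ∀ i j, f i j * f j j = f i j)
    (horth : ∀ i j, i ≠ j → f i i * f j j = 0) (hsum : ∑ i, f i i = 1)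
    (hcomm : ∀ a i j, α a * f i j = f i j * α a)
    (hspan : ∀ x i j, ∃ a, f i i * x * f j j = α a * f i j) :
    ∃ n : ℕ, n ≠ 0 ∧ Nonempty (Matrix (Fin n) (Fin n) A ≃ₐ[F] S) := by
  classical
  obtain ⟨o, ho⟩ : ∃ i, f i i ≠ 0 := by
    by_contra! h
    simp [h] at hsum
  -- Some diagonal idempotents may vanish; only the surviving indices contribute to the size of the
  -- matrix algebra.
  let T := {i // f i i ≠ 0}
  have hne (i : T) : f o i * f i o ≠ 0 := by
    intro h0
    -- By simplicity of `S`, `1` is a sum of terms `s * f i i * t`. Each term is killed between two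
    -- copies of `f o o`, since `hspan` reduces it to a multiple of `f o i * f i o`.
    have : f o o * 1 * f o o = 0 := by
      refine one_mem_span_of_ne_zero i.2 (p := fun x => f o o * x * f o o = 0) (by simp) ?_ ?_
      · intro x y hx hy
        rw [mul_add, add_mul, hx, hy, add_zero]
      · intro s t
        obtain ⟨a, ha⟩ := hspan s o i
        obtain ⟨b, hb⟩ := hspan t i o
        calc f o o * (s * f i i * t) * f o o
            = (f o o * s * f i i) * (f i i * t * f o o) := by
              simp only [mul_assoc, ← mul_assoc (f i i) (f i i), hleft]
          _ = α a * α b * (f o i * f i o) := by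
              rw [ha, hb, mul_assoc, ← mul_assoc (f o i), ← hcomm]
              simp only [mul_assoc]
          _ = 0 := by rw [h0, mul_zero]
    rw [mul_one, hleft] at this
    exact ho this
  choose r hr using fun i : T => hmul o i o
  have hr0 (i : T) : r i ≠ 0 := fun h => hne i (by rw [hr, h, zero_smul])
  -- A column and a row through the base index `o`, scaled so that `v i * u i = f o o`; the products
  -- `u i * v j` are then matrix units.
  let u (i : T) : S := (r i)⁻¹ • f i o
  let v (i : T) : S := f o i
  have hvu (i j : T) : v i * u j = if i = j then f o o else 0 := by
    split_ifs with h
    · subst h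
      simp only [u, v, mul_smul_comm, hr, smul_smul, inv_mul_cancel₀ (hr0 i), one_smul]
    · have h' : (i : ι) ≠ j := fun h' => h (Subtype.ext h')
      simp only [u, v, mul_smul_comm]
      rw [← hright o i, ← hleft j o, mul_assoc, ← mul_assoc (f i i), horth _ _ h']
      simp
  have hov (i : T) : f o o * v i = v i := hleft _ _
  have huv (i : T) : u i * v i = f i i := by
    obtain ⟨s, hs⟩ := hmul i o i
    -- Bracketing this product in the two possible ways compares the scalars of `f o i * f i o` and
    -- `f i o * f o i`.
    have h1 : f o i * f i o * f o i = s • f o i := by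
      rw [mul_assoc, hs, mul_smul_comm, hright]
    have h2 : r i • f o i = s • f o i := by rw [← h1, hr, smul_mul_assoc, hleft]
    have h3 : f o i ≠ 0 := fun h => hne i (by rw [h, zero_mul])
    have h4 : r i = s := smul_left_injective F h3 h2
    simp only [u, v, smul_mul_assoc, hs, ← h4, smul_smul, inv_mul_cancel₀ (hr0 i), one_smul]
  have hcu (a) (i : T) : α a * u i = u i * α a := by
    simp only [u, mul_smul_comm, smul_mul_assoc, hcomm]
  have hcv (a) (i : T) : α a * v i = v i * α a := hcomm _ _ _
  have hsumT (g : ι → S) (hg : ∀ i, f i i = 0 → g i = 0) : ∑ i : T, g i = ∑ i, g i := by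
    rw [← Finset.sum_subtype (Finset.univ.filter fun i => f i i ≠ 0) (by simp) g]
    refine Finset.sum_subset (Finset.filter_subset _ _) fun i _ hi => hg i ?_
    simpa using hi
  obtain ⟨φ, hφ⟩ := exists_algHom_matrix_of_matrixUnits α (fun i j : T => u i * v j)
    (fun i j k l => by
      rw [mul_assoc, ← mul_assoc (v j), hvu]
      split_ifs <;> simp [hov])
    (by simp only [huv]; rw [hsumT (fun i => f i i) (fun _ h => h), hsum])
    (fun a i j => by rw [← mul_assoc, hcu, mul_assoc, hcv, mul_assoc])
  -- Insert `f i i = u i * v i` and `f j j = u j * v j` on the two sides of `f i j`; the middle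
  -- factor `v i * f i j * u j` is a scalar multiple of `f o o`.
  have hf (i j : T) : ∃ s : F, f i j = s • (u i * v j) := by
    obtain ⟨s, hs⟩ := hmul o i j
    obtain ⟨t, ht⟩ := hmul o j o
    refine ⟨(r j)⁻¹ * s * t, ?_⟩
    calc f i j = (f i i * f i j) * f j j := by rw [hleft, hright]
      _ = u i * ((f o i * f i j) * u j) * v j := by
        rw [← huv i, ← huv j]; simp only [mul_assoc, v]
      _ = _ := by
        rw [hs]
        simp only [u, smul_mul_assoc, mul_smul_comm, ht, hright, smul_smul]
        congr 1
        ring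
  have : Nonempty T := ⟨⟨o, ho⟩⟩
  have hbij : Function.Bijective φ := by
    -- Injectivity is simplicity of the matrix algebra over the simple ring `A`. For surjectivity,
    -- `x` is the sum of its Peirce components `f i i * x * f j j`, each of which is a multiple of
    -- `u i * v j` by an element of `A`.
    refine ⟨φ.toRingHom.injective, fun x => ?_⟩
    choose a ha using hspan x
    choose s hs using hf
    refine ⟨Matrix.of fun i j => s i j • a i j, ?_⟩
    rw [hφ]
    simp only [Matrix.of_apply]
    calc ∑ i : T, ∑ j : T, α (s i j • a i j) * (u i * v j)
        = ∑ i : T, ∑ j : T, f i i * x * f j j := by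
          refine Finset.sum_congr rfl fun i _ => Finset.sum_congr rfl fun j _ => ?_
          rw [ha, hs i j, map_smul, smul_mul_assoc, mul_smul_comm]
      _ = ∑ i, ∑ j, f i i * x * f j j := by
          rw [← hsumT (fun i => ∑ j, f i i * x * f j j) (fun i h => by simp [h])]
          refine Finset.sum_congr rfl fun i _ => ?_
          exact hsumT (fun j => f i i * x * f j j) (fun j h => by simp [h])
      _ = x := by
          simp only [← Finset.mul_sum, hsum, mul_one, ← Finset.sum_mul, one_mul]
  let e : Fin (Fintype.card T) ≃ T := (Fintype.equivFin T).symm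
  exact ⟨Fintype.card T, Fintype.card_ne_zero,
    ⟨(Matrix.reindexAlgEquiv F A e).trans (AlgEquiv.ofBijective φ hbij)⟩⟩

end MatrixUnits

/-! ## The nucleus as an associative algebra -/

section NuclearAlgebra

variable (F : Type*) [Field F] (R : Type*) [NonAssocRing R] [Module F R] [SMulCommClass F R R]
  [IsScalarTower F R R]

theorem mem_nucleus_iff {R : Type*} [NonUnitalNonAssocRing R] {x : R} :
    x ∈ nucleus R ↔ ∀ a b : R, x * a * b = x * (a * b) ∧ a * x * b = a * (x * b) ∧
      a * b * x = a * (b * x) := by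
  simp only [nucleus, Set.mem_ofPred_eq, associator_apply, sub_eq_zero]

/-- The nucleus as a subspace. -/
def nucleusSubmodule : Submodule F R where
  carrier := nucleus R
  add_mem' := nucleus_add
  zero_mem' := mem_nucleus_iff.2 fun a b => by simp
  smul_mem' r x hx := mem_nucleus_iff.2 fun a b => by
    obtain ⟨h1, h2, h3⟩ := mem_nucleus_iff.1 hx a b
    simp [smul_mul_assoc, mul_smul_comm, h1, h2, h3]

/-- The nucleus as an algebra. -/
abbrev NucleusAlgebra : Type _ := nucleusSubmodule F R

variable {F R}

/-- Each of the three identities follows by rebracketing around one nuclear factor at a time. -/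
theorem mul_mem_nucleus {x y : R} (hx : x ∈ nucleus R) (hy : y ∈ nucleus R) :
    x * y ∈ nucleus R := by
  rw [mem_nucleus_iff] at *
  have hx1 a b := (hx a b).1
  have hx2 a b := (hx a b).2.1
  have hx3 a b := (hx a b).2.2
  have hy1 a b := (hy a b).1
  have hy2 a b := (hy a b).2.1
  have hy3 a b := (hy a b).2.2
  refine fun a b => ⟨?_, ?_, ?_⟩
  · rw [hx1, hx1, hy1, ← hx1]
  · rw [← hx2, hy2, hx2, ← hx1]
  · rw [← hx2, hx3, hy3, hy3]

theorem one_mem_nucleus : (1 : R) ∈ nucleus R := mem_nucleus_iff.2 fun a b => by simp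

instance : Mul (NucleusAlgebra F R) where
  mul x y := ⟨x * y, mul_mem_nucleus x.2 y.2⟩

instance : One (NucleusAlgebra F R) where
  one := ⟨1, one_mem_nucleus⟩

theorem NucleusAlgebra.coe_mul (x y : NucleusAlgebra F R) : ((x * y : NucleusAlgebra F R) : R) = x * y := rfl

instance : Ring (NucleusAlgebra F R) where
  left_distrib _ _ _ := Subtype.ext (mul_add _ _ _)
  right_distrib _ _ _ := Subtype.ext (add_mul _ _ _)
  zero_mul _ := Subtype.ext (zero_mul _)
  mul_zero _ := Subtype.ext (mul_zero _)
  mul_assoc x _ _ := Subtype.ext (mem_nucleus_iff.1 x.2 _ _).1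
  one_mul _ := Subtype.ext (one_mul _)
  mul_one _ := Subtype.ext (mul_one _)
  neg_add_cancel := neg_add_cancel
  sub_eq_add_neg := sub_eq_add_neg
  zsmul := zsmulRec

instance : Algebra F (NucleusAlgebra F R) :=
  Algebra.ofModule (fun r x y => Subtype.ext (smul_mul_assoc r (x : R) (y : R)))
    (fun r x y => Subtype.ext (mul_smul_comm r (x : R) (y : R)))

theorem IsAlgIso.nucleus {R' : Type*} [NonAssocRing R'] [Module F R'] [SMulCommClass F R' R']
    [IsScalarTower F R' R'] (h : IsAlgIso F R R') :
    Nonempty (NucleusAlgebra F R ≃ₐ[F] NucleusAlgebra F R') := by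
  obtain ⟨e, he⟩ := h
  have hone : e 1 = 1 := by
    have h1 := he 1 (e.symm 1)
    rw [one_mul, e.apply_symm_apply, mul_one] at h1
    exact h1.symm
  -- The nucleus is defined by multiplicative identities quantified over the whole algebra, so a
  -- multiplicative bijection preserves it.
  have hmap : (nucleusSubmodule F R).map (e : R →ₗ[F] R') = nucleusSubmodule F R' := by
    ext y
    obtain ⟨x, rfl⟩ := e.surjective y
    rw [Submodule.mem_map_equiv, e.symm_apply_apply]
    change x ∈ _root_.nucleus R ↔ e x ∈ _root_.nucleus R'
    rw [mem_nucleus_iff, mem_nucleus_iff, e.surjective.forall₂]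
    simp only [← he, e.injective.eq_iff]
  let f : NucleusAlgebra F R ≃ₗ[F] NucleusAlgebra F R' := e.ofSubmodules _ _ hmap
  exact ⟨AlgEquiv.ofLinearEquiv f (Subtype.ext hone) fun x y => Subtype.ext (he x y)⟩

end NuclearAlgebra

/-- A nontrivial finite-dimensional algebra has a simple quotient. -/
theorem exists_simple_quotient (F : Type*) [Field F] (N : Type v) [Ring N] [Nontrivial N]
    [Algebra F N] [Module.Finite F N] :
    ∃ (S : Type v) (_ : Ring S) (_ : Algebra F S) (_ : IsSimpleRing S) (π : N →ₐ[F] S),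
      Function.Surjective π := by
  have : IsNoetherianRing N := isNoetherian_of_tower F inferInstance
  -- An `Ideal` of a noncommutative ring is a left ideal, so two-sidedness is imposed as a
  -- condition; a maximal element exists by the Noetherian property.
  obtain ⟨I, ⟨hI, hne⟩, hmax⟩ := exists_maximal_of_wellFoundedGT
    (fun I : Ideal N => I.IsTwoSided ∧ I ≠ ⊤) ⟨⊥, inferInstance, bot_ne_top⟩
  refine ⟨N ⧸ I, inferInstance, inferInstance, ?_, Ideal.Quotient.mkₐ F I,
    Ideal.Quotient.mkₐ_surjective F I⟩
  rw [isSimpleRing_iff_isTwoSided_imp]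
  refine ⟨Ideal.Quotient.nontrivial_iff.2 hne, fun J hJ => ?_⟩
  have hsurj := Ideal.Quotient.mk_surjective (I := I)
  rw [or_iff_not_imp_right]
  intro hJtop
  have hc : J.comap (Ideal.Quotient.mk I) ≤ I := by
    refine hmax ⟨inferInstance, fun h => hJtop ?_⟩ fun x hx => ?_
    · rw [eq_top_iff]
      intro y _
      obtain ⟨x, rfl⟩ := hsurj y
      have : x ∈ J.comap (Ideal.Quotient.mk I) := h ▸ Submodule.mem_top
      exact this
    · rw [Ideal.mem_comap, Ideal.Quotient.eq_zero_iff_mem.2 hx]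
      exact J.zero_mem
  rw [eq_bot_iff]
  intro y hy
  obtain ⟨x, rfl⟩ := hsurj y
  exact Ideal.Quotient.eq_zero_iff_mem.2 (hc hy)

/-! ### Matrix units and Peirce components in a skew matrix algebra -/

namespace SkewMatrix

variable {F ι : Type*} [Field F] [DecidableEq ι] (c : SkewSet F ι)

/-- The matrix units. -/
def single (i j : ι) : SkewMatrix c := fun k l => if k = i ∧ l = j then 1 else 0

theorem single_apply (i j k l : ι) : single c i j k l = if k = i ∧ l = j then 1 else 0 := rfl

variable [Fintype ι]

theorem single_mul_single (i j l : ι) :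
    single c i j * single c j l = c.coeff i j l • single c i l := by
  ext p q
  rw [mul_apply, Finset.sum_eq_single j]
  · simp only [single_apply, smul_apply]
    by_cases hp : p = i <;> by_cases hq : q = l <;> simp [hp, hq]
  · intro k _ hk
    simp [single_apply, hk]
  · simp

theorem single_mul_single_of_ne {i j k l : ι} (h : j ≠ k) :
    single c i j * single c k l = 0 := by
  ext p q
  rw [mul_apply]
  refine Finset.sum_eq_zero fun m _ => ?_
  simp only [single_apply]
  by_cases hm : m = j
  · subst hm; simp [h]
  · simp [hm]

theorem sum_single : ∑ i, single c i i = 1 := by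
  ext p q
  let ev : SkewMatrix c →+ F :=
    { toFun := fun x => x p q, map_zero' := rfl, map_add' := fun _ _ => rfl }
  have h : (∑ i, single c i i) p q = ∑ i, single c i i p q := map_sum ev _ _
  rw [h, one_apply]
  simp only [single_apply]
  rw [Finset.sum_eq_single p]
  · simp [eq_comm]
  · intro k _ hk; simp [hk.symm]
  · simp

/-- The normalisation `c i i j = 1` is what makes left multiplication by `e_ii` a plain truncation
to row `i`. -/
theorem single_diag_mul_apply (x : SkewMatrix c) (i k l : ι) :
    (single c i i * x) k l = if k = i then x k l else 0 := by
  rw [mul_apply, Finset.sum_eq_single i]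
  · by_cases hk : k = i
    · subst hk; simp [single_apply, c.left_one]
    · simp [single_apply, hk]
  · intro m _ hm; simp [single_apply, hm]
  · simp

theorem mul_single_diag_apply (x : SkewMatrix c) (i k l : ι) :
    (x * single c i i) k l = if l = i then x k l else 0 := by
  rw [mul_apply, Finset.sum_eq_single i]
  · by_cases hk : l = i
    · subst hk; simp [single_apply, c.right_one]
    · simp [single_apply, hk]
  · intro m _ hm; simp [single_apply, hm]
  · simp

theorem single_mul_mul_single (x : SkewMatrix c) (i j : ι) :
    single c i i * x * single c j j = x i j • single c i j := by
  ext k l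
  rw [mul_single_diag_apply, single_diag_mul_apply, smul_apply, single_apply]
  by_cases hk : k = i <;> by_cases hl : l = j <;> simp [hk, hl]

/-- Multiplication by `e_ii` only selects a row or a column, or in the middle position one summand
of the product, so every bracketing gives the same entries. -/
theorem single_diag_mem_nucleus (i : ι) : single c i i ∈ nucleus (SkewMatrix c) := by
  refine mem_nucleus_iff.2 fun a b => ⟨?_, ?_, ?_⟩
  · ext k l
    rw [single_diag_mul_apply, mul_apply, mul_apply]
    simp only [single_diag_mul_apply]
    split_ifs <;> simp
  · ext k l
    rw [mul_apply, mul_apply]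
    refine Finset.sum_congr rfl fun m _ => ?_
    rw [single_diag_mul_apply, mul_single_diag_apply]
    split_ifs <;> simp
  · ext k l
    rw [mul_single_diag_apply, mul_apply, mul_apply]
    simp only [mul_single_diag_apply]
    split_ifs <;> simp

end SkewMatrix

/-- Every simple quotient of the nucleus of `A ⊗ M`, with `A` simple and `M` a skew matrix algebra,
is a matrix algebra over `A`. -/
theorem exists_algEquiv_matrix_of_nucleus_surjective {F A S ι : Type*} [Field F] [Ring A]
    [Algebra F A] [IsSimpleRing A] [Fintype ι] [DecidableEq ι] (c : SkewSet F ι) [Ring S]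
    [Algebra F S] [IsSimpleRing S] (π : NucleusAlgebra F (A ⊗[F] SkewMatrix c) →ₐ[F] S)
    (hπ : Function.Surjective π) :
    ∃ n : ℕ, n ≠ 0 ∧ Nonempty (Matrix (Fin n) (Fin n) A ≃ₐ[F] S) := by
  classical
  have hA (a : A) : a ∈ nucleus A := mem_nucleus_iff.2 fun _ _ => by simp [mul_assoc]
  let α₀ : A →ₐ[F] NucleusAlgebra F (A ⊗[F] SkewMatrix c) := AlgHom.ofLinearMap
    { toFun := fun a => ⟨a ⊗ₜ 1, NuclearEmbedding.tmul_mem_nucleus (hA a) one_mem_nucleus⟩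
      map_add' := fun a b => Subtype.ext (TensorProduct.add_tmul _ _ _)
      map_smul' := fun r a => Subtype.ext (TensorProduct.smul_tmul' _ _ _).symm }
    rfl (fun a b => Subtype.ext (by simp [NucleusAlgebra.coe_mul]))
  have hα (a : A) : (α₀ a : A ⊗[F] SkewMatrix c) = a ⊗ₜ 1 := rfl
  let P (i j : ι) : Prop := (1 : A) ⊗ₜ[F] SkewMatrix.single c i j ∈ nucleus (A ⊗[F] SkewMatrix c)
  -- A unit outside the nucleus is replaced by `0`; by simplicity of `A`, the corresponding Peirce
  -- piece of the nucleus is then zero as well.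
  let f₀ (i j : ι) : NucleusAlgebra F (A ⊗[F] SkewMatrix c) :=
    if h : P i j then ⟨1 ⊗ₜ SkewMatrix.single c i j, h⟩ else 0
  have hf₀ (i j) (h : P i j) :
      (f₀ i j : A ⊗[F] SkewMatrix c) = 1 ⊗ₜ SkewMatrix.single c i j := by
    simp only [f₀, dif_pos h]
  have hf₀' (i j) (h : ¬ P i j) : f₀ i j = 0 := dif_neg h
  have hP (i) : P i i :=
    NuclearEmbedding.tmul_mem_nucleus (hA 1) (SkewMatrix.single_diag_mem_nucleus c i)
  refine exists_algEquiv_matrix_of_peirce (π.comp α₀) (fun i j => π (f₀ i j)) ?_ ?_ ?_ ?_ ?_ ?_ ?_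
  · intro i j l
    by_cases h : P i j
    swap
    · exact ⟨0, by simp [hf₀' _ _ h]⟩
    by_cases h' : P j l
    swap
    · exact ⟨0, by simp [hf₀' _ _ h']⟩
    have hmul : ((f₀ i j * f₀ j l : NucleusAlgebra F _) : A ⊗[F] SkewMatrix c) =
        c.coeff i j l • (1 ⊗ₜ SkewMatrix.single c i l) := by
      rw [NucleusAlgebra.coe_mul, hf₀ _ _ h, hf₀ _ _ h', Algebra.TensorProduct.tmul_mul_tmul, mul_one,
        SkewMatrix.single_mul_single, TensorProduct.tmul_smul]
    refine ⟨c.coeff i j l, ?_⟩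
    rw [← map_mul, ← map_smul]
    congr 1
    apply Subtype.ext
    rw [hmul, Submodule.coe_smul]
    -- If the coefficient vanishes, both sides are zero whatever `f₀ i l` is. Otherwise `1 ⊗ e_il`
    -- is a scalar multiple of a product of nuclear elements, hence nuclear.
    by_cases hc : c.coeff i j l = 0
    · rw [hc, zero_smul, zero_smul]
    · rw [hf₀]
      have h1 := (nucleusSubmodule F _).smul_mem (c.coeff i j l)⁻¹ (f₀ i j * f₀ j l).2
      rwa [hmul, smul_smul, inv_mul_cancel₀ hc, one_smul] at h1
  · intro i j
    rw [← map_mul]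
    by_cases h : P i j
    · congr 1
      apply Subtype.ext
      rw [NucleusAlgebra.coe_mul, hf₀ _ _ h, hf₀ _ _ (hP i), Algebra.TensorProduct.tmul_mul_tmul, mul_one,
        SkewMatrix.single_mul_single, c.left_one, one_smul]
    · simp [hf₀' _ _ h]
  · intro i j
    rw [← map_mul]
    by_cases h : P i j
    · congr 1
      apply Subtype.ext
      rw [NucleusAlgebra.coe_mul, hf₀ _ _ h, hf₀ _ _ (hP j), Algebra.TensorProduct.tmul_mul_tmul, mul_one,
        SkewMatrix.single_mul_single, c.right_one, one_smul]
    · simp [hf₀' _ _ h]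
  · intro i j hij
    rw [← map_mul, ← map_zero π]
    congr 1
    apply Subtype.ext
    rw [NucleusAlgebra.coe_mul, hf₀ _ _ (hP i), hf₀ _ _ (hP j), Algebra.TensorProduct.tmul_mul_tmul,
      SkewMatrix.single_mul_single_of_ne c hij, TensorProduct.tmul_zero]
    rfl
  · rw [← map_sum, ← map_one π]
    congr 1
    apply Subtype.ext
    rw [Submodule.coe_sum]
    simp only [hf₀ _ _ (hP _), ← TensorProduct.tmul_sum, SkewMatrix.sum_single]
    rfl
  · intro a i j
    rw [AlgHom.comp_apply, ← map_mul, ← map_mul]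
    by_cases h : P i j
    · congr 1
      apply Subtype.ext
      rw [NucleusAlgebra.coe_mul, NucleusAlgebra.coe_mul, hf₀ _ _ h, hα]
      simp
    · simp [hf₀' _ _ h]
  · intro x i j
    obtain ⟨z, rfl⟩ := hπ x
    -- The `(i, j)` Peirce component of the whole tensor product is `A ⊗ e_ij`.
    have hz (z : A ⊗[F] SkewMatrix c) : ∃ a : A, 1 ⊗ₜ SkewMatrix.single c i i * z *
        1 ⊗ₜ SkewMatrix.single c j j = a ⊗ₜ SkewMatrix.single c i j := by
      induction z with
      | zero => exact ⟨0, by simp⟩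
      | add z w hz hw =>
        obtain ⟨a, ha⟩ := hz
        obtain ⟨b, hb⟩ := hw
        exact ⟨a + b, by rw [mul_add, add_mul, ha, hb, TensorProduct.add_tmul]⟩
      | tmul a x =>
        refine ⟨x i j • a, ?_⟩
        rw [Algebra.TensorProduct.tmul_mul_tmul, Algebra.TensorProduct.tmul_mul_tmul, one_mul,
          mul_one, SkewMatrix.single_mul_mul_single, TensorProduct.tmul_smul,
          TensorProduct.smul_tmul']
    obtain ⟨a, ha⟩ := hz z
    have hmem : a ⊗ₜ[F] SkewMatrix.single c i j ∈ nucleus (A ⊗[F] SkewMatrix c) := by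
      rw [← ha]
      exact mul_mem_nucleus (mul_mem_nucleus (hP i) z.2) (hP j)
    refine ⟨a, ?_⟩
    rw [AlgHom.comp_apply, ← map_mul, ← map_mul, ← map_mul]
    congr 1
    apply Subtype.ext
    rw [NucleusAlgebra.coe_mul, NucleusAlgebra.coe_mul, NucleusAlgebra.coe_mul, hα, hf₀ _ _ (hP i), hf₀ _ _ (hP j), ha]
    by_cases h0 : a = 0
    · simp [h0]
    · rw [hf₀]
      · simp
      -- The `a` with `a ⊗ e_ij` nuclear are closed under sums and under multiplication by `A` on
      -- both sides, so one nonzero such `a` forces `1 ⊗ e_ij` into the nucleus.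
      · refine one_mem_span_of_ne_zero h0
          (p := fun a => a ⊗ₜ[F] SkewMatrix.single c i j ∈ nucleus (A ⊗[F] SkewMatrix c))
          ?_ ?_ ?_
        · rw [TensorProduct.zero_tmul]
          exact (nucleusSubmodule F _).zero_mem
        · intro x y hx hy
          rw [TensorProduct.add_tmul]
          exact nucleus_add hx hy
        · intro s t
          have := mul_mem_nucleus (mul_mem_nucleus (α₀ s).2 hmem) (α₀ t).2
          simpa [hα] using this

/-- Skew equivalent central simple algebras are Brauer equivalent. -/
theorem IsSkewEquivalent.isBrauerEquivalent {F : Type u} [Field F] {A B : CSA.{u, v} F}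
    (h : IsSkewEquivalent F A B) : IsBrauerEquivalent A B := by
  obtain ⟨n, n', c, c', hn, hn', h⟩ := h
  obtain ⟨e⟩ := h.nucleus
  have : Nonempty (Fin n) := ⟨⟨0, hn⟩⟩
  have : Module.Finite F (SkewMatrix c) := inferInstanceAs (Module.Finite F (Matrix _ _ F))
  have : Nontrivial (SkewMatrix c) := inferInstanceAs (Nontrivial (Matrix (Fin n) (Fin n) F))
  have : Nontrivial (NucleusAlgebra F (A ⊗[F] SkewMatrix c)) :=
    ⟨0, 1, fun h => zero_ne_one (α := A ⊗[F] SkewMatrix c) (congrArg Subtype.val h)⟩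
  obtain ⟨S, _, _, _, π, hπ⟩ := exists_simple_quotient F (NucleusAlgebra F (A ⊗[F] SkewMatrix c))
  obtain ⟨k, hk, ⟨f⟩⟩ := exists_algEquiv_matrix_of_nucleus_surjective c π hπ
  -- The same `S` is a quotient of the nucleus of `B ⊗ M_{n'}(F;c')`, through the inverse of `e`.
  obtain ⟨l, hl, ⟨g⟩⟩ := exists_algEquiv_matrix_of_nucleus_surjective c'
    (π.comp e.symm.toAlgHom) (hπ.comp e.symm.surjective)
  exact ⟨k, l, hk, hl, ⟨f.trans g.symm⟩⟩

/-! ## Maximal separable subfields of division algebras -/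

section Division

variable {F D : Type*} [Field F] [DivisionRing D] [Algebra F D] [Algebra.IsCentral F D]
  [Module.Finite F D]

/-- The dimension formula for the centralizer of a subfield of a central division algebra. -/
theorem finrank_mul_finrank_centralizer {L : Type*} [CommRing L] [IsSimpleRing L] [Algebra F L]
    [Module.Finite F L] (g : L →ₐ[F] D) :
    Module.finrank F L * Module.finrank F (Subalgebra.centralizer F (Set.range g)) =
      Module.finrank F D := by
  classical
  let ρL : L →ₐ[F] Module.End F D := AlgHom.ofLinearMap
    ((LinearMap.mul F D).flip.comp g.toLinearMap) (by ext; simp) (fun k l => by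
      ext a
      rw [mul_comm k l]
      simp [mul_assoc])
  -- `D` becomes a module over `D ⊗ L` by `(d ⊗ l) a = d a g(l)`: faithful because `D ⊗ L` is
  -- simple, and simple because left multiplications alone act transitively on nonzero elements.
  let ρ : D ⊗[F] L →ₐ[F] Module.End F D :=
    Algebra.TensorProduct.lift (Algebra.lmul F D) ρL fun d l => by
      ext a
      exact (mul_assoc d a (g l)).symm
  have hρ (d : D) (l : L) (a : D) : ρ (d ⊗ₜ l) a = d * (a * g l) := by
    simp only [ρ]
    rfl
  have := isSimpleRing_tensor (F := F) D L
  have hinj : Function.Injective ρ := ρ.toRingHom.injective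
  let : Module (D ⊗[F] L) D := Module.compHom D ρ.toRingHom
  have hsmul (r : D ⊗[F] L) (a : D) : r • a = ρ r a := rfl
  have : IsScalarTower F (D ⊗[F] L) D := ⟨fun r x a => by
    rw [hsmul, hsmul, map_smul, LinearMap.smul_apply]⟩
  have : SMulCommClass (D ⊗[F] L) F D := ⟨fun x r a => by
    rw [hsmul, hsmul, map_smul]⟩
  have : IsSimpleModule (D ⊗[F] L) D := by
    rw [isSimpleModule_iff_toSpanSingleton_surjective]
    refine ⟨inferInstance, fun a ha x => ⟨(x * a⁻¹) ⊗ₜ 1, ?_⟩⟩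
    rw [LinearMap.toSpanSingleton_apply, hsmul, hρ]
    simp [ha]
  let E := Module.End (D ⊗[F] L) D
  have : Module.Finite E D := Module.Finite.of_restrictScalars_finite F E D
  -- By Schur, `E` is a division ring, and by the density theorem `D ⊗ L` is all of `End_E(D)`. As
  -- an `F`-space the latter is a sum of `[D:E]` copies of `D`, whence `[L:F] = [D:E]`.
  have hsurj := Module.Finite.toModuleEnd_moduleEnd_surjective (R := D ⊗[F] L) (M := D)
  let b := Module.finBasis E D
  let e₁ : (Fin (Module.finrank E D) → D) ≃ₗ[F] (D →ₗ[E] D) := b.constr F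
  let τ : D ⊗[F] L →ₗ[F] (D →ₗ[E] D) :=
    { toFun := fun r => Module.toModuleEnd E (S := D ⊗[F] L) D r
      map_add' := fun r s => map_add _ _ _
      map_smul' := fun c r => LinearMap.ext fun a => smul_assoc c r a }
  have hτ : Function.Bijective τ := by
    refine ⟨fun r s h => hinj (LinearMap.ext fun a => ?_), hsurj⟩
    exact LinearMap.congr_fun h a
  have h1 := ((LinearEquiv.ofBijective τ hτ).trans e₁.symm).finrank_eq
  rw [Module.finrank_tensorProduct, Module.finrank_pi_fintype] at h1
  simp only [Finset.sum_const, Finset.card_univ, Fintype.card_fin, smul_eq_mul] at h1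
  rw [mul_comm] at h1
  have h2 : Module.finrank F L = Module.finrank E D :=
    Nat.eq_of_mul_eq_mul_right Module.finrank_pos h1
  have h3 : Module.finrank F E * Module.finrank E D = Module.finrank F D :=
    Module.finrank_mul_finrank F E D
  -- An endomorphism commuting with left multiplications is right multiplication by its value at
  -- `1`; commuting with the action of `L` says that this value centralizes `g(L)`.
  let ε : E ≃ₗ[F] Subalgebra.centralizer F (Set.range g) :=
    { toFun := fun f => ⟨f 1, by
        rw [Subalgebra.mem_centralizer_iff]
        rintro _ ⟨l, rfl⟩
        have h := f.map_smul ((1 : D) ⊗ₜ[F] l) 1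
        have h' := f.map_smul ((g l) ⊗ₜ[F] (1 : L)) 1
        simp only [hsmul, hρ, one_mul, map_one, mul_one] at h h'
        rw [← h', h]⟩
      map_add' := fun _ _ => rfl
      map_smul' := fun _ _ => rfl
      invFun := fun c =>
        { toFun := fun a => a * c
          map_add' := fun a b => add_mul a b _
          map_smul' := fun r a => by
            have hc (l : L) : g l * c = c * g l :=
              Subalgebra.mem_centralizer_iff F |>.1 c.2 _ ⟨l, rfl⟩
            simp only [hsmul, RingHom.id_apply]
            induction r with
            | zero => simp
            | add r s hr hs => simp only [map_add, LinearMap.add_apply, add_mul, hr, hs]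
            | tmul d l => rw [hρ, hρ, mul_assoc, mul_assoc, mul_assoc, hc] }
      left_inv := fun f => LinearMap.ext fun a => by
        have h := f.map_smul (a ⊗ₜ[F] (1 : L)) 1
        simp only [hsmul, hρ, map_one, mul_one] at h
        exact h.symm
      right_inv := fun c => Subtype.ext (one_mul _) }
  rw [← ε.finrank_eq, h2, mul_comm, h3]

end Division

/-- A separable field inside a central division algebra that is smaller than its centralizer can
be enlarged. -/
theorem exists_larger_separable {F D L : Type u} [Field F] [DivisionRing D] [Algebra F D]
    [Algebra.IsCentral F D] [Module.Finite F D] [Field L] [Algebra F L] [Algebra.IsSeparable F L]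
    (g : L →ₐ[F] D)
    (hne : Module.finrank F L ≠ Module.finrank F (Subalgebra.centralizer F (Set.range g))) :
    ∃ (M : Type u) (_ : Field M) (_ : Algebra F M) (_ : Algebra.IsSeparable F M) (_ : M →ₐ[F] D),
      Module.finrank F L < Module.finrank F M := by
  have : Module.Finite F L := Module.Finite.of_injective g.toLinearMap g.toRingHom.injective
  set C := Subalgebra.centralizer F (Set.range g)
  let : DivisionRing C := divisionRingOfFiniteDimensional F C
  have hgC (l : L) : g l ∈ C := by
    rw [Subalgebra.mem_centralizer_iff]
    rintro _ ⟨m, rfl⟩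
    rw [← map_mul, mul_comm, map_mul]
  let g' : L →ₐ[F] C := g.codRestrict C hgC
  have hcomm (l : L) (x : C) : g' l * x = x * g' l :=
    Subtype.ext (Subalgebra.mem_centralizer_iff F |>.1 x.2 _ ⟨l, rfl⟩)
  let : Algebra L C := g'.toRingHom.toAlgebra' hcomm
  have : IsScalarTower F L C := .of_algebraMap_eq' g'.comp_algebraMap.symm
  have : Module.Finite L C := Module.Finite.of_restrictScalars_finite F L C
  -- the center of the centralizer is `L`
  let Z := Subalgebra.center F C
  let gZ : Z →ₐ[F] D := C.val.comp Z.val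
  have hZfield : IsField Z := (fieldOfFiniteDimensional F Z).toIsField
  have : IsSimpleRing Z := (isSimpleRing_iff_isField Z).2 hZfield
  have hLZ (l : L) : g' l ∈ Z := Subalgebra.mem_center_iff.2 fun x => (hcomm l x).symm
  let gLZ : L →ₐ[F] Z := g'.codRestrict Z hLZ
  -- `L` and the center `Z ⊇ L` of `C` have the same centralizer `C`, so the dimension formula,
  -- applied to both, gives `[L:F] = [Z:F]` and hence `Z = L`.
  have hcent : Subalgebra.centralizer F (Set.range gZ) = C := by
    apply le_antisymm
    · apply Subalgebra.centralizer_le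
      rintro _ ⟨l, rfl⟩
      exact ⟨gLZ l, rfl⟩
    · intro x hx
      rw [Subalgebra.mem_centralizer_iff]
      rintro _ ⟨z, rfl⟩
      exact (congrArg Subtype.val (Subalgebra.mem_center_iff.1 z.2 ⟨x, hx⟩)).symm
  have hdim : Module.finrank F L = Module.finrank F Z := by
    have h1 := finrank_mul_finrank_centralizer g
    have h2 := finrank_mul_finrank_centralizer gZ
    rw [hcent, ← h1] at h2
    exact (Nat.eq_of_mul_eq_mul_right Module.finrank_pos h2).symm
  have hsurj : Function.Surjective gLZ :=
    (LinearMap.injective_iff_surjective_of_finrank_eq_finrank (f := gLZ.toLinearMap) hdim).1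
      gLZ.toRingHom.injective
  have : Algebra.IsCentral L C := ⟨fun x hx => by
    obtain ⟨l, hl⟩ := hsurj ⟨x, Subalgebra.mem_center_iff.2 (Subalgebra.mem_center_iff.1 hx)⟩
    exact Algebra.mem_bot.2 ⟨l, congrArg Subtype.val hl⟩⟩
  have hbot : (⊥ : Subalgebra L C) ≠ ⊤ := by
    intro h
    apply hne
    refine LinearEquiv.finrank_eq (LinearEquiv.ofBijective g'.toLinearMap
      ⟨g'.toRingHom.injective, fun x => ?_⟩)
    have hx : x ∈ (⊥ : Subalgebra L C) := h ▸ Algebra.mem_top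
    exact Algebra.mem_bot.1 hx
  -- Jacobson–Noether: the central division `L`-algebra `C ≠ L` contains a separable element outside
  -- `L`.
  obtain ⟨x, hx, hsep⟩ := JacobsonNoether.exists_separable_and_not_isCentral' hbot
  have hint : IsIntegral L x := Algebra.IsIntegral.isIntegral x
  have hirr : Irreducible (minpoly L x) := minpoly.irreducible hint
  have : Fact (Irreducible (minpoly L x)) := ⟨hirr⟩
  -- An abstract copy of `L(x)`; evaluation at `x` maps it into the noncommutative ring `C`.
  let M := AdjoinRoot (minpoly L x)
  have hmin : minpoly L (AdjoinRoot.root (minpoly L x)) = minpoly L x := by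
    rw [AdjoinRoot.minpoly_root hirr.ne_zero, (minpoly.monic hint).leadingCoeff]
    simp
  have : Algebra.IsSeparable L M := by
    have h1 : IsSeparable L (AdjoinRoot.root (minpoly L x)) := by
      rw [IsSeparable, hmin]
      exact hsep
    have h2 := (IntermediateField.isSeparable_adjoin_simple_iff_isSeparable L M).2 h1
    rw [IntermediateField.adjoin_root_eq_top] at h2
    exact AlgEquiv.Algebra.isSeparable (IntermediateField.topEquiv (F := L) (E := M))
  have : Algebra.IsSeparable F M := Algebra.IsSeparable.trans F L M
  let φ : M →ₐ[L] C := Ideal.Quotient.liftₐ (Ideal.span {minpoly L x})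
    (Polynomial.aeval x) fun q hq => by
      obtain ⟨q, rfl⟩ := Ideal.mem_span_singleton'.1 hq
      rw [map_mul, minpoly.aeval, mul_zero]
  refine ⟨M, inferInstance, inferInstance, this, C.val.comp (φ.restrictScalars F), ?_⟩
  have hdeg : Module.finrank L M = (minpoly L x).natDegree :=
    (AdjoinRoot.powerBasis hirr.ne_zero).finrank.trans (AdjoinRoot.powerBasis_dim _)
  have hdeg1 : 1 < (minpoly L x).natDegree := by
    refine (minpoly.two_le_natDegree_iff hint).2 ?_
    exact fun h => hx (Algebra.mem_bot.2 h)
  have : Module.Finite L M := (AdjoinRoot.powerBasis hirr.ne_zero).finite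
  rw [← Module.finrank_mul_finrank F L M, hdeg]
  exact lt_mul_of_one_lt_right Module.finrank_pos hdeg1

/-- A central division algebra of dimension `d` has a separable subfield of degree `√d`. -/
theorem exists_separable_finrank_sq (F D : Type u) [Field F] [DivisionRing D] [Algebra F D]
    [Algebra.IsCentral F D] [Module.Finite F D] :
    ∃ (L : Type u) (_ : Field L) (_ : Algebra F L) (_ : Algebra.IsSeparable F L) (_ : L →ₐ[F] D),
      Module.finrank F L * Module.finrank F L = Module.finrank F D := by
  let p (n : ℕ) : Prop := ∃ (L : Type u) (_ : Field L) (_ : Algebra F L)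
    (_ : Algebra.IsSeparable F L) (_ : L →ₐ[F] D), Module.finrank F L = n
  have hbound (n : ℕ) (hn : p n) : n ≤ Module.finrank F D := by
    obtain ⟨L, _, _, _, g, rfl⟩ := hn
    exact LinearMap.finrank_le_finrank_of_injective (f := g.toLinearMap) g.toRingHom.injective
  classical
  have hp1 : p 1 := ⟨F, inferInstance, inferInstance, inferInstance, Algebra.ofId F D,
    Module.finrank_self F⟩
  -- A separable subfield of largest degree: degrees are bounded by `[D:F]`, and `F` itself has
  -- degree `1`.
  obtain ⟨L, _, _, _, g, hL⟩ : p (Nat.findGreatest p (Module.finrank F D)) :=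
    Nat.findGreatest_spec (hbound 1 hp1) hp1
  refine ⟨L, inferInstance, inferInstance, inferInstance, g, ?_⟩
  have : Module.Finite F L := Module.Finite.of_injective g.toLinearMap g.toRingHom.injective
  conv_rhs => rw [← finrank_mul_finrank_centralizer g]
  congr 1
  by_contra hne
  obtain ⟨M, _, _, _, h, hlt⟩ := exists_larger_separable g hne
  have hM : p (Module.finrank F M) := ⟨M, inferInstance, inferInstance, inferInstance, h, rfl⟩
  have := Nat.le_findGreatest (hbound _ hM) hM
  omega

/-! ## Central simple algebras are semiassociative -/

/-- A central simple algebra with an étale subalgebra of maximal dimension is semiassociative. -/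
theorem IsSemiassociative.of_finrank_mul_self {F : Type u} {A K : Type v} [Field F] [Ring A]
    [Algebra F A] [Algebra.IsCentral F A] [IsSimpleRing A] [Module.Finite F A] [CommRing K]
    [Algebra F K] [Algebra.Etale F K] (f : K →ₐ[F] A) (hf : Function.Injective f)
    (hdim : Module.finrank F K * Module.finrank F K = Module.finrank F A) :
    IsSemiassociative F A where
  finite := inferInstance
  nontrivial := inferInstance
  center_eq := (center_subset A).antisymm (by rintro _ ⟨r, rfl⟩; exact smul_one_mem_center r)
  exists_etale := by
    let φ : NuclearEmbedding F K A :=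
      { toLinearMap := f.toLinearMap
        map_one := map_one f
        map_mul := map_mul f
        injective := hf
        mem_nucleus := fun k a b => by simp [associator_apply, mul_assoc] }
    have hφ (k : K) : φ k = f k := rfl
    refine ⟨K, inferInstance, inferInstance, inferInstance, φ,
      (minimallyFaithful_iff_of_etale φ).2 ?_⟩
    have := etale_tensor (F := F) K K
    have : Module.Finite F K := Algebra.FormallyUnramified.finite_of_free F _
    have : IsReduced (K ⊗[F] K) := Algebra.FormallyUnramified.isReduced_of_field F _
    have : IsArtinianRing (K ⊗[F] K) := IsArtinianRing.of_finite F _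
    -- With `fop`, the action of `K ⊗ K` factors as `K ⊗ K → A ⊗ Aᵐᵒᵖ → End A`. The first map is
    -- injective by flatness, the second by simplicity.
    let fop : K →ₗ[F] Aᵐᵒᵖ := (MulOpposite.opLinearEquiv F).toLinearMap.comp f.toLinearMap
    have hfop : Function.Injective fop := (MulOpposite.opLinearEquiv F).injective.comp hf
    have := isSimpleRing_tensor (F := F) A Aᵐᵒᵖ
    have hinj : Function.Injective φ.biAction := by
      have h1 : Function.Injective (AlgHom.mulLeftRight F A) :=
        (AlgHom.mulLeftRight F A).toRingHom.injective
      have h2 : Function.Injective (TensorProduct.map f.toLinearMap fop) :=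
        TensorProduct.map_injective_of_flat_flat _ _ hf hfop
      convert h1.comp h2 using 1
      funext r
      rw [Function.comp_apply]
      induction r with
      | zero => simp
      | add x y hx hy => rw [map_add, map_add, map_add, hx, hy]
      | tmul k l =>
        ext a
        rw [φ.biAction_tmul, TensorProduct.map_tmul, AlgHom.mulLeftRight_apply, mul_assoc]
        rfl
    let := φ.bimodule
    have : FaithfulSMul (K ⊗[F] K) A := ⟨fun h => hinj (LinearMap.ext h)⟩
    obtain ⟨v, hv⟩ := exists_smul_injective (R := K ⊗[F] K) (M := A)
    refine ⟨v, hv, ?_⟩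
    -- The orbit map of `v` is injective between spaces of equal dimension, hence bijective.
    let g : K ⊗[F] K →ₗ[F] A := (LinearMap.applyₗ v).comp φ.biAction.toLinearMap
    exact (LinearMap.injective_iff_surjective_of_finrank_eq_finrank (f := g)
      (by rw [Module.finrank_tensorProduct, hdim])).1 hv

/-- Every central simple algebra is semiassociative. -/
theorem IsSemiassociative.of_central_simple (F A : Type u) [Field F] [Ring A] [Algebra F A]
    [Algebra.IsCentral F A] [IsSimpleRing A] [Module.Finite F A] : IsSemiassociative F A := by
  have : IsArtinianRing A := IsArtinianRing.of_finite F A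
  obtain ⟨n, _, D, _, _, _, ⟨e⟩⟩ := IsSimpleRing.exists_algEquiv_matrix_divisionRing_finite F A
  -- A central `d` gives a central scalar matrix, which corresponds to a scalar of `F` in `A`; its
  -- entry at `(0, 0)` recovers `d`.
  have : Algebra.IsCentral F D := ⟨fun d hd => by
    have h1 : Matrix.scalar (Fin n) d ∈ Subalgebra.center F (Matrix (Fin n) (Fin n) D) := by
      rw [Matrix.subalgebraCenter_eq_scalarAlgHom_map]
      exact ⟨d, hd, rfl⟩
    have h2 : e.symm (Matrix.scalar (Fin n) d) ∈ Subalgebra.center F A := by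
      rw [Subalgebra.mem_center_iff] at h1 ⊢
      intro a
      apply e.injective
      simpa using h1 (e a)
    rw [Algebra.IsCentral.center_eq_bot, Algebra.mem_bot] at h2
    obtain ⟨r, hr⟩ := h2
    have h3 := congrArg e hr
    rw [e.commutes, e.apply_symm_apply] at h3
    refine Algebra.mem_bot.2 ⟨r, ?_⟩
    simpa [Matrix.algebraMap_matrix_apply] using congrFun (congrFun h3 0) 0⟩
  obtain ⟨L, _, _, _, g, hL⟩ := exists_separable_finrank_sq F D
  have : Module.Finite F L := Module.Finite.of_injective g.toLinearMap g.toRingHom.injective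
  have : Algebra.FormallyEtale F L := Algebra.FormallyEtale.of_isSeparable F L
  have : Algebra.FinitePresentation F L := Algebra.FinitePresentation.of_finiteType.1 inferInstance
  have : Algebra.Etale F L := {}
  -- The étale algebra `L^n` of diagonal matrices has dimension `n [L:F]`, whose square is `n² [D:F]
  -- = dim A`.
  let δ : (Fin n → L) →ₐ[F] Matrix (Fin n) (Fin n) D :=
    (Matrix.diagonalAlgHom F).comp (AlgHom.compLeft g (Fin n))
  have hδ : Function.Injective δ :=
    Matrix.diagonal_injective.comp (g.toRingHom.injective.comp_left)
  refine IsSemiassociative.of_finrank_mul_self (e.symm.toAlgHom.comp δ)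
    (e.symm.injective.comp hδ) ?_
  rw [e.toLinearEquiv.finrank_eq, Module.finrank_matrix, Module.finrank_pi_fintype, ← hL]
  simp
  ring

/-! ## The embedding of the Brauer group -/

/-- Matrices over `A` are the tensor product of `A` with a skew matrix algebra. -/
theorem isAlgIso_tensor_skewMatrix_matrix (F A : Type*) [Field F] [Ring A] [Algebra F A] (n : ℕ) :
    ∃ c : SkewSet F (Fin n), IsAlgIso F (A ⊗[F] SkewMatrix c) (Matrix (Fin n) (Fin n) A) := by
  -- With all coefficients equal to `1` the skew product is the ordinary matrix product.
  let c : SkewSet F (Fin n) := ⟨fun _ _ _ => 1, fun _ _ => rfl, fun _ _ => rfl⟩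
  have h : IsAlgIso F (SkewMatrix c) (Matrix (Fin n) (Fin n) F) :=
    ⟨LinearEquiv.refl F (Matrix (Fin n) (Fin n) F), fun x y => by
      ext i j
      change (x * y : SkewMatrix c) i j = _
      rw [SkewMatrix.mul_apply, Matrix.mul_apply]
      simp [c]
      rfl⟩
  exact ⟨c, (IsAlgIso.refl.tensor h).trans ⟨(matrixEquivTensor (Fin n) F A).symm.toLinearEquiv,
    fun x y => map_mul (matrixEquivTensor (Fin n) F A).symm x y⟩⟩

/-- Brauer equivalent algebras are skew equivalent. -/
theorem IsBrauerEquivalent.isSkewEquivalent {F : Type u} [Field F] {A B : CSA.{u, v} F}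
    (h : IsBrauerEquivalent A B) : IsSkewEquivalent F A B := by
  obtain ⟨n, m, hn, hm, ⟨e⟩⟩ := h
  obtain ⟨c, hc⟩ := isAlgIso_tensor_skewMatrix_matrix F A n
  obtain ⟨d, hd⟩ := isAlgIso_tensor_skewMatrix_matrix F B m
  exact ⟨n, m, c, d, Nat.pos_of_ne_zero hn, Nat.pos_of_ne_zero hm,
    hc.trans (.trans ⟨e.toLinearEquiv, map_mul e⟩ hd.symm)⟩

namespace CSA

variable {F : Type u} [Field F]

/-- A central simple algebra as a semiassociative algebra. -/
def toSemiassocAlg (A : CSA.{u, u} F) : SemiassocAlg F where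
  carrier := A
  isSemiassociative := .of_central_simple F A

end CSA

/-- The homomorphism from the Brauer group to the semiassociative Brauer monoid. -/
noncomputable def brauerToSemiassoc (F : Type u) [Field F] :
    BrauerGroup.{u, u} F →* SemiassocBrauerMonoid F where
  toFun := Quotient.lift (fun A => SemiassocBrauerMonoid.mk A.toSemiassocAlg)
    fun _ _ h => Quotient.sound (IsBrauerEquivalent.isSkewEquivalent h)
  map_one' := rfl
  map_mul' := by
    rintro ⟨A⟩ ⟨B⟩
    -- Both classes are represented by `A ⊗ B` with the same multiplication, so the identity map is
    -- the isomorphism.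
    exact Quotient.sound (.of_iso ⟨LinearEquiv.refl F (A ⊗[F] B), fun x y => rfl⟩)

theorem mainTheorem4 (F : Type u) [Field F] :
    (∀ A B : CSA.{u, v} F, IsSkewEquivalent F A B → IsBrauerEquivalent A B) ∧
    ∃ f : BrauerGroup.{u, u} F →* SemiassocBrauerMonoid F, Function.Injective f ∧
      ∀ A : CSA.{u, u} F, ∃ h : IsSemiassociative F A,
        f (Quotient.mk (Brauer.CSA_Setoid F) A) =
          SemiassocBrauerMonoid.mk { carrier := A, isSemiassociative := h } := by
  refine ⟨fun A B h => h.isBrauerEquivalent, brauerToSemiassoc F, ?_,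
    fun A => ⟨.of_central_simple F A, rfl⟩⟩
  rintro ⟨A⟩ ⟨B⟩ h
  -- Equality of semiassociative classes is skew equivalence, so injectivity is the first assertion
  -- read on classes.
  have h' : IsSkewEquivalent F A B := Quotient.exact h
  exact Quotient.sound h'.isBrauerEquivalent
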